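/- Work over $\mathbb{C}$. Let $n\ge 0$, $d\ge 0$, $g\ge 1$ be integers with $n\le 2g$ and $d\ge\max(n,2g-2)$. Let $M^n_d$ be the space of nondegenerate morphisms $f=(F_0:\dots:F_n):\mathbb{P}^1\to\mathbb{P}^n$ of degree $d$, each identified with the coefficients of its parametrizing forms: it is the Zariski-open subset of $\mathbb{C}^{(n+1)(d+1)}$ of $(n+1)$-tuples of linearly independent binary forms of degree $d$ without common zero in $\mathbb{P}^1$. For a point $q\in\mathbb{P}^1$ with local parameter $t$, write $f$ near $q$ as $t\mapsto(f_1(t),\dots,f_n(t))$ in affine coordinates centred at $f(q)$. The value semigroup of $f$ at $q$ is the set of $t$-adic valuations of the nonzero elements of the image of $\mathbb{C}[[x_1,\dots,x_n]]\to\mathbb{C}[[t]]$, $x_i\mapsto f_i(t)$. The vanishing orders of $f$ at $q$ are the $n+1$ integers $k_0<k_1<\dots<k_n$ that occur as orders at $t=0$ of nonzero linear combinations of $1,f_1,\dots,f_n$. Let $\mathcal{V}\subset M^n_d$ be the set of morphisms $f$ that are birational onto their image and whose image has exactly one singular point, this point being unibranch with value semigroup $\langle 2,2g+1\rangle$ (a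 hyperelliptic cusp of genus $g$). For $\mathbf{k}=(k_0,\dots,k_n)\in\mathbb{Z}_{\ge0}^{n+1}$ let $\mathcal{V}_{\mathbf{k}}\subset\mathcal{V}$ be the set of those $f$ whose sequence of vanishing orders at the preimage of the cusp is $\mathbf{k}$. If $\mathcal{V}_{\mathbf{k}}\neq\emptyset$, then $$\operatorname{cod}(\mathcal{V}_{\mathbf{k}},M^n_d)\;\ge\;(n-1)g+\sum_{i=2}^n\left(\frac{k_i}{2}-i\right).$$ In particular (and whenever $\mathcal{V}\ne\emptyset$), $\operatorname{cod}(\mathcal{V},M^n_d)\ge (n-1)g$. Here $\operatorname{cod}(Y,M^n_d)=\dim M^n_d-\dim Y$, where the dimension of a subset of affine space is the dimension of its Zariski closure. -/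

import Mathlib

noncomputable section

namespace HyperellipticCusp

/-- A point of the affine space of `(n+1)`-tuples of binary forms of degree `d`:
`a (i, j)` is the coefficient of `x ^ (d - j) * y ^ j` in the `i`-th form `F_i`. -/
abbrev Coeffs (n d : ℕ) : Type := Fin (n + 1) × Fin (d + 1) → ℂ

/-- The value `F_i(x, y)` of the `i`-th form, for `x`, `y` in a commutative `ℂ`-algebra. -/
def formAt {n d : ℕ} (a : Coeffs n d) {A : Type} [CommRing A] [Algebra ℂ A]
    (i : Fin (n + 1)) (x y : A) : A :=
  ∑ j : Fin (d + 1), a (i, j) • (x ^ (d - (j : ℕ)) * y ^ (j : ℕ))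

/-- Two nonzero vectors are proportional, that is, they give the same point of projective space. -/
def SamePoint {m : ℕ} (u v : Fin m → ℂ) : Prop :=
  ∀ i j, u i * v j = u j * v i

/-- The vector `(F_0(v), …, F_n(v))`. -/
def evalAt {n d : ℕ} (a : Coeffs n d) (v : Fin 2 → ℂ) : Fin (n + 1) → ℂ :=
  fun i => formAt a i (v 0) (v 1)

/-- The space `M^n_d` of nondegenerate morphisms `ℙ¹ → ℙⁿ` of degree `d`, each identified with
the coefficients of its parametrizing forms: the forms have no common zero on `ℙ¹`, and they are
linearly independent. -/
def Mor (n d : ℕ) : Set (Coeffs n d) :=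
  {a | (∀ v : Fin 2 → ℂ, v ≠ 0 → evalAt a v ≠ 0) ∧
    LinearIndependent ℂ (fun (i : Fin (n + 1)) (j : Fin (d + 1)) => a (i, j))}

/-- The power series `F_i(v + t w)` in `t`. If `v`, `w` is a basis of `ℂ²`, then `t` is a local
parameter of `ℙ¹` at the point `[v]`. -/
def expansion {n d : ℕ} (a : Coeffs n d) (v w : Fin 2 → ℂ) (i : Fin (n + 1)) : PowerSeries ℂ :=
  formAt a i (PowerSeries.C (v 0) + PowerSeries.C (w 0) * PowerSeries.X)
    (PowerSeries.C (v 1) + PowerSeries.C (w 1) * PowerSeries.X)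

/-- `v`, `w` is a basis of `ℂ²` and the affine chart `z_j ≠ 0` of `ℙⁿ` contains the image
of the point `[v]`. -/
def IsLocalChart {n d : ℕ} (a : Coeffs n d) (v w : Fin 2 → ℂ) (j : Fin (n + 1)) : Prop :=
  v 0 * w 1 - v 1 * w 0 ≠ 0 ∧ evalAt a v j ≠ 0

/-- The local section `F_i / F_j` as a power series in `t`; it equals `1` for `i = j`. -/
def localSection {n d : ℕ} (a : Coeffs n d) (v w : Fin 2 → ℂ) (j i : Fin (n + 1)) :
    PowerSeries ℂ :=
  expansion a v w i * (expansion a v w j)⁻¹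

/-- The `n` power series that describe the morphism near `[v]`, in the affine coordinates
`z_i / z_j` (`i ≠ j`) translated so that the image of `[v]` is the origin. -/
def localCoord {n d : ℕ} (a : Coeffs n d) (v w : Fin 2 → ℂ) (j : Fin (n + 1)) (i : Fin n) :
    PowerSeries ℂ :=
  localSection a v w j (j.succAbove i) -
    PowerSeries.C (PowerSeries.constantCoeff (localSection a v w j (j.succAbove i)))

/-- The power series describing the morphism near a point may be substituted into power series. -/
theorem hasSubst_localCoord {n d : ℕ} (a : Coeffs n d) (v w : Fin 2 → ℂ) (j : Fin (n + 1)) :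
    MvPowerSeries.HasSubst (localCoord a v w j) :=
  MvPowerSeries.hasSubst_of_constantCoeff_zero fun i => by
    change PowerSeries.constantCoeff (localCoord a v w j i) = 0
    simp [localCoord]

/-- The local ring homomorphism `φ : ℂ⟦x_1, …, x_n⟧ → ℂ⟦t⟧`, `x_i ↦ f_i(t)`. -/
def localHom {n d : ℕ} (a : Coeffs n d) (v w : Fin 2 → ℂ) (j : Fin (n + 1)) :
    MvPowerSeries (Fin n) ℂ →ₐ[ℂ] PowerSeries ℂ :=
  MvPowerSeries.substAlgHom (hasSubst_localCoord a v w j)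

/-- The value semigroup: the set of `t`-adic valuations of the nonzero elements of the
image of `φ`. -/
def valueSemigroup {n d : ℕ} (a : Coeffs n d) (v w : Fin 2 → ℂ) (j : Fin (n + 1)) : Set ℕ :=
  {m | ∃ h : MvPowerSeries (Fin n) ℂ, (localHom a v w j h).order = (m : ℕ∞)}

/-- The set of vanishing orders at `t = 0` of the nonzero linear combinations of the local
sections. -/
def vanishingOrders {n d : ℕ} (a : Coeffs n d) (v w : Fin 2 → ℂ) (j : Fin (n + 1)) : Set ℕ :=
  {m | ∃ c : Fin (n + 1) → ℂ, (∑ i, c i • localSection a v w j i).order = (m : ℕ∞)}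

/-- The morphism is injective, and every point of its image other than the image of `[v]` is
smooth (its value semigroup is all of `ℕ`). So the morphism is birational onto its image, every
point of the image is unibranch, and only the image of `[v]` may be singular. -/
def SmoothAwayFrom {n d : ℕ} (a : Coeffs n d) (v : Fin 2 → ℂ) : Prop :=
  (∀ u u' : Fin 2 → ℂ, u ≠ 0 → u' ≠ 0 → SamePoint (evalAt a u) (evalAt a u') → SamePoint u u') ∧
  ∀ (u w : Fin 2 → ℂ) (j : Fin (n + 1)), IsLocalChart a u w j → ¬ SamePoint u v →
    valueSemigroup a u w j = Set.univ

/-- The locus in `M^n_d` of the morphisms whose image is unicuspidal with value semigroup `S`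
at the cusp (for `S ≠ ℕ`). -/
def cuspLocus (n d : ℕ) (S : Set ℕ) : Set (Coeffs n d) :=
  {a | a ∈ Mor n d ∧ ∃ (v w : Fin 2 → ℂ) (j : Fin (n + 1)), IsLocalChart a v w j ∧
    SmoothAwayFrom a v ∧ valueSemigroup a v w j = S}

/-- The stratum of `cuspLocus n d S` of the morphisms for which the strictly increasing sequence
of vanishing orders in the preimage of the cusp is `k = (k_0, …, k_n)`. -/
def cuspStratum (n d : ℕ) (S : Set ℕ) (k : Fin (n + 1) → ℕ) : Set (Coeffs n d) :=
  {a | a ∈ Mor n d ∧ ∃ (v w : Fin 2 → ℂ) (j : Fin (n + 1)), IsLocalChart a v w j ∧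
    SmoothAwayFrom a v ∧ valueSemigroup a v w j = S ∧
    StrictMono k ∧ vanishingOrders a v w j = Set.range k}

/-- The numerical semigroup `⟨2, 2g + 1⟩`. -/
def hyperellipticSemigroup (g : ℕ) : Set ℕ :=
  (AddSubmonoid.closure ({2, 2 * g + 1} : Set ℕ) : Set ℕ)

/-- The dimension of a subset of affine space: the Krull dimension of the coordinate ring of its
Zariski closure (`⊥` for the empty set). -/
def zariskiDim {σ : Type} (X : Set (σ → ℂ)) : WithBot ℕ∞ :=
  ringKrullDim (MvPolynomial σ ℂ ⧸ MvPolynomial.vanishingIdeal ℂ X)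

/-- The subset `Y` of the irreducible variety `X` has codimension `c`: `dim X = dim Y + c`. -/
def HasCodim {σ : Type} (Y X : Set (σ → ℂ)) (c : ℕ) : Prop :=
  zariskiDim Y + ((c : ℕ∞) : WithBot ℕ∞) = zariskiDim X

end HyperellipticCusp

end

/-! Choose a local parameter at the cusp through a basis of ℂ² that depends on a single number θ,
and let E_i be the expansions of the forms. Up to a common unit factor they lie in the local ring of
the cusp, which has no element of odd order below 2g+1. Row reduction gives E = A G with G in
reduced echelon form of orders k_0 = 0, k_1 = 2, k_2, …. Put H = G_1/G_0, of order 2. Subtracting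
multiples of the powers of H never leaves a remainder of odd order below 2g, so G_i ≡ Σ_{j<g} c_j
G_0 H^j mod t^(2g) (`IsCuspidal.exists_dvd_sub`). For i ≥ 2 the even coefficients of G_i therefore
determine the c_j, and these determine the odd coefficients below t^(2g).

So the morphism is a rational function of θ, A and the remaining coefficients of G, and
`zariskiDim_range_le` bounds the dimension by the number of these parameters. Since `Mor n d` is
dense, the count for 2g ≤ d+1 gives codimension at least (n-1)g + Σ_{i≥2} (p_i - i), where p_i is
the position of k_i in ⟨2, 2g+1⟩. Both claims follow from p_i ≥ k_i/2 and p_i ≥ i.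

For d = 2g-2 the exponent 2g-1 exceeds the degree, and each row i ≥ 2 has one determined coefficient
fewer. Let m be the largest j < g for which G_0 H^j has a nonzero coefficient at t^(2g-1). If k_i <
2m, the vanishing of this coefficient in G_i determines c_m, which makes up for the loss. The value
k_i = 2m is impossible. At most g-1-m rows have k_i > 2m, and the vanishing for m < j < g determines
as many odd coefficients of G_1. If no such j exists, m = 1 serves. The two steps are
`mem_range_point` and `card_parameters_le`. -/

noncomputable section

namespace HyperellipticCusp

/-! ### Dimension of Zariski closures and rational parametrizations. -/

section

open MvPolynomial

/-- An integral extension does not increase the Krull dimension. -/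
theorem ringKrullDim_le_of_isIntegral {R S : Type*} [CommRing R] [CommRing S] [Algebra R S]
    [Algebra.IsIntegral R S] : ringKrullDim S ≤ ringKrullDim R := by
  refine Order.krullDim_le_of_strictMono (PrimeSpectrum.comap (algebraMap R S)) ?_
  intro p q hpq
  exact Ideal.IsIntegral.comap_lt_comap (I := p.asIdeal) (J := q.asIdeal) hpq

/-- A finitely generated algebra that embeds into a domain of transcendence degree at most `N`
has Krull dimension at most `N`. -/
theorem ringKrullDim_le_of_injective {A K : Type} [CommRing A] [Algebra ℂ A]
    [Algebra.FiniteType ℂ A] [CommRing K] [IsDomain K] [Algebra ℂ K] (N : ℕ)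
    (hK : Algebra.trdeg ℂ K ≤ N) (f : A →ₐ[ℂ] K) (hf : Function.Injective f) :
    ringKrullDim A ≤ N := by
  have : Nontrivial A := f.toRingHom.domain_nontrivial
  -- Noether normalization: `A` has dimension at most `s`, and the `s` variables remain
  -- algebraically independent in `K`.
  obtain ⟨s, h, hinj, hintegral⟩ := exists_integral_inj_algHom_of_fg ℂ A
  have hs : s ≤ N := by
    have h1 := lift_trdeg_le_of_injective (f.comp h) (hf.comp hinj)
    rw [MvPolynomial.trdeg_of_isDomain] at h1
    simp only [Cardinal.mk_fin, Cardinal.lift_id] at h1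
    exact_mod_cast h1.trans hK
  let _ : Algebra (MvPolynomial (Fin s) ℂ) A := h.toRingHom.toAlgebra
  have : Algebra.IsIntegral (MvPolynomial (Fin s) ℂ) A := ⟨hintegral⟩
  refine (ringKrullDim_le_of_isIntegral (R := MvPolynomial (Fin s) ℂ)).trans ?_
  rw [MvPolynomial.ringKrullDim_of_isNoetherianRing, ringKrullDim_eq_zero_of_field]
  simpa using hs

theorem zariskiDim_mono {σ : Type} {X Y : Set (σ → ℂ)} (h : X ⊆ Y) :
    zariskiDim X ≤ zariskiDim Y :=
  ringKrullDim_le_of_surjective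
    (Ideal.Quotient.factor (vanishingIdeal_anti_mono h)) (Ideal.Quotient.factor_surjective _)

theorem zariskiDim_empty {σ : Type} : zariskiDim (∅ : Set (σ → ℂ)) = ⊥ := by
  rw [zariskiDim, vanishingIdeal_empty]
  exact ringKrullDim_eq_bot_of_subsingleton

theorem zariskiDim_nonneg {σ : Type} {X : Set (σ → ℂ)} (h : X.Nonempty) : 0 ≤ zariskiDim X := by
  obtain ⟨x, hx⟩ := h
  have : Nontrivial (MvPolynomial σ ℂ ⧸ vanishingIdeal ℂ X) := by
    refine Ideal.Quotient.nontrivial_iff.mpr fun h => ?_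
    have : (1 : MvPolynomial σ ℂ) ∈ vanishingIdeal ℂ X := h ▸ Submodule.mem_top
    simpa using mem_vanishingIdeal_iff.mp this x hx
  exact ringKrullDim_nonneg_of_nontrivial

theorem zariskiDim_le_card {σ : Type} [Fintype σ] (X : Set (σ → ℂ)) :
    zariskiDim X ≤ (Fintype.card σ : ℕ) := by
  refine (ringKrullDim_quotient_le _).trans ?_
  rw [MvPolynomial.ringKrullDim_of_isNoetherianRing, ringKrullDim_eq_zero_of_field]
  simp

theorem zariskiDim_eq_card {σ : Type} [Fintype σ] {X : Set (σ → ℂ)}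
    (h : ∀ p : MvPolynomial σ ℂ, (∀ x ∈ X, eval x p = 0) → p = 0) :
    zariskiDim X = (Fintype.card σ : ℕ) := by
  have : vanishingIdeal ℂ X = (⊥ : Ideal (MvPolynomial σ ℂ)) := by
    refine eq_bot_iff.mpr fun p hp => ?_
    exact h p fun x hx => by simpa [aeval_eq_eval] using mem_vanishingIdeal_iff.mp hp x hx
  rw [zariskiDim, this, ringKrullDim_eq_of_ringEquiv (RingEquiv.quotientBot _),
    MvPolynomial.ringKrullDim_of_isNoetherianRing, ringKrullDim_eq_zero_of_field]
  simp

/-- The dimension of a finite union is at most the maximum of the dimensions. -/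
theorem zariskiDim_le_of_subset_iUnion {σ ι : Type} [Finite ι] {Y : Set (σ → ℂ)}
    (Z : ι → Set (σ → ℂ)) (N : WithBot ℕ∞) (hY : Y ⊆ ⋃ i, Z i) (hZ : ∀ i, zariskiDim (Z i) ≤ N) :
    zariskiDim Y ≤ N := by
  have := Fintype.ofFinite ι
  refine (zariskiDim_mono hY).trans ?_
  rw [zariskiDim, ringKrullDim_quotient]
  refine iSup_le fun l => ?_
  have hmem : vanishingIdeal ℂ (⋃ i, Z i) ≤ (l.head.1).asIdeal := l.head.2
  have hle : Finset.univ.inf (fun i => vanishingIdeal ℂ (Z i)) ≤ l.head.1.asIdeal := by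
    refine le_trans (fun p hp => ?_) hmem
    rw [mem_vanishingIdeal_iff]
    intro x hx
    obtain ⟨i, hi⟩ := Set.mem_iUnion.mp hx
    have : p ∈ vanishingIdeal ℂ (Z i) := (Finset.inf_le (Finset.mem_univ i) :
      Finset.univ.inf (fun i => vanishingIdeal ℂ (Z i)) ≤ _) hp
    exact mem_vanishingIdeal_iff.mp this x hi
  -- The smallest prime of the chain contains a finite intersection of ideals, hence one of them;
  -- the whole chain then lies over that one.
  obtain ⟨i, -, hi⟩ := (Ideal.IsPrime.inf_le' l.head.1.isPrime).mp hle
  refine le_trans ?_ (hZ i)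
  rw [zariskiDim, ringKrullDim_quotient]
  let l' : LTSeries (PrimeSpectrum.zeroLocus (R := MvPolynomial σ ℂ)
      (vanishingIdeal ℂ (Z i))) :=
    { length := l.length
      toFun := fun j => ⟨(l j).1, hi.trans (LTSeries.head_le l j)⟩
      step := fun j => l.step j }
  exact Order.LTSeries.length_le_krullDim l'

/-- The function `f` on `X` is a rational function of the functions `u t`, without poles. -/
def IsRational {X T : Type} (u : T → X → ℂ) (f : X → ℂ) : Prop :=
  ∃ p q : MvPolynomial T ℂ, ∀ x, eval (fun t => u t x) q ≠ 0 ∧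
    f x * eval (fun t => u t x) q = eval (fun t => u t x) p

namespace IsRational

variable {X T : Type} {u : T → X → ℂ} {f h : X → ℂ}

theorem const (c : ℂ) : IsRational u (fun _ => c) := ⟨C c, 1, by simp⟩

theorem coord (t : T) : IsRational u (u t) := ⟨.X t, 1, by simp⟩

theorem add (hf : IsRational u f) (hh : IsRational u h) : IsRational u (fun x => f x + h x) := by
  obtain ⟨p, q, H⟩ := hf
  obtain ⟨p', q', H'⟩ := hh
  refine ⟨p * q' + p' * q, q * q', fun x => ⟨?_, ?_⟩⟩
  · simpa using ⟨(H x).1, (H' x).1⟩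
  · simp only [map_add, map_mul, ← (H x).2, ← (H' x).2]; ring

theorem mul (hf : IsRational u f) (hh : IsRational u h) : IsRational u (fun x => f x * h x) := by
  obtain ⟨p, q, H⟩ := hf
  obtain ⟨p', q', H'⟩ := hh
  refine ⟨p * p', q * q', fun x => ⟨?_, ?_⟩⟩
  · simpa using ⟨(H x).1, (H' x).1⟩
  · simp only [map_mul, ← (H x).2, ← (H' x).2]; ring

theorem neg (hf : IsRational u f) : IsRational u (fun x => - f x) := by
  simpa using (const (-1)).mul hf

theorem sub (hf : IsRational u f) (hh : IsRational u h) : IsRational u (fun x => f x - h x) := by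
  simpa [sub_eq_add_neg] using hf.add hh.neg

theorem pow (hf : IsRational u f) (m : ℕ) : IsRational u (fun x => f x ^ m) := by
  induction m with
  | zero => simpa using const 1
  | succ m ih => simpa [pow_succ] using ih.mul hf

theorem inv (hf : IsRational u f) (h0 : ∀ x, f x ≠ 0) : IsRational u (fun x => (f x)⁻¹) := by
  obtain ⟨p, q, H⟩ := hf
  refine ⟨q, p, fun x => ?_⟩
  rw [← (H x).2]
  exact ⟨mul_ne_zero (h0 x) (H x).1, by rw [inv_mul_cancel_left₀ (h0 x)]⟩

theorem sum {ι : Type*} {s : Finset ι} {F : ι → X → ℂ} (hF : ∀ i ∈ s, IsRational u (F i)) :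
    IsRational u (fun x => ∑ i ∈ s, F i x) := by
  classical
  induction s using Finset.induction_on with
  | empty => simpa using const 0
  | insert a s ha ih =>
    simp only [Finset.sum_insert ha]
    exact (hF a (Finset.mem_insert_self _ _)).add
      (ih fun i hi => hF i (Finset.mem_insert_of_mem hi))

theorem congr (hf : IsRational u f) (e : ∀ x, h x = f x) : IsRational u h := by
  rwa [show h = f from funext e]

end IsRational

/-- A set whose coordinates are rational functions of `N` functions has dimension at
most `N`. -/
theorem zariskiDim_range_le {X T σ : Type} [Fintype T] [Finite σ] (u : T → X → ℂ)
    (y : X → σ → ℂ) (hy : ∀ s, IsRational u (fun x => y x s)) :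
    zariskiDim (Set.range y) ≤ (Fintype.card T : ℕ) := by
  rcases isEmpty_or_nonempty X with hX | ⟨⟨x₀⟩⟩
  · rw [Set.range_eq_empty, zariskiDim_empty]; exact bot_le
  choose p q H using hy
  let P := MvPolynomial T ℂ
  let K := FractionRing P
  let ψ : MvPolynomial σ ℂ →ₐ[ℂ] K := aeval fun s => algebraMap P K (p s) / algebraMap P K (q s)
  have hq : ∀ s, algebraMap P K (q s) ≠ 0 := by
    intro s h0
    have : q s = 0 := (FaithfulSMul.algebraMap_injective P K) (by simpa using h0)
    exact (H s x₀).1 (by simp [this])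
  -- A single fraction `N / Q` represents both `ψ f` and the values of `f` on the set. As `Q` has no
  -- zero there, `ψ f = 0` makes `f` vanish on the set. Relations among the `u t` do no harm.
  have key : ∀ f : MvPolynomial σ ℂ, ∃ N Q : P, (∀ x, eval (fun t => u t x) Q ≠ 0) ∧
      ψ f * algebraMap P K Q = algebraMap P K N ∧
      ∀ x, aeval (y x) f * eval (fun t => u t x) Q = eval (fun t => u t x) N := by
    intro f
    induction f using MvPolynomial.induction_on with
    | C c =>
      refine ⟨C c, 1, by simp, ?_, by simp⟩
      rw [map_one, mul_one]
      change ψ (algebraMap ℂ (MvPolynomial σ ℂ) c) = algebraMap P K (algebraMap ℂ P c)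
      rw [AlgHom.commutes, ← IsScalarTower.algebraMap_apply ℂ P K]
    | add f f' ih ih' =>
      obtain ⟨N, Q, h1, h2, h3⟩ := ih
      obtain ⟨N', Q', h1', h2', h3'⟩ := ih'
      refine ⟨N * Q' + N' * Q, Q * Q', fun x => ?_, ?_, fun x => ?_⟩
      · simpa using ⟨h1 x, h1' x⟩
      · simp only [map_add, map_mul, ← h2, ← h2']; ring
      · simp only [map_add, map_mul, ← h3, ← h3']; ring
    | mul_X f s ih =>
      obtain ⟨N, Q, h1, h2, h3⟩ := ih
      refine ⟨N * p s, Q * q s, fun x => ?_, ?_, fun x => ?_⟩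
      · simpa using ⟨h1 x, (H s x).1⟩
      · have : ψ (.X s) = algebraMap P K (p s) / algebraMap P K (q s) := aeval_X _ _
        rw [map_mul, map_mul, map_mul, ← h2, this, mul_mul_mul_comm, div_mul_cancel₀ _ (hq s)]
      · simp only [map_mul, ← h3, aeval_X, ← (H s x).2]; ring
  have hker : RingHom.ker ψ ≤ vanishingIdeal ℂ (Set.range y) := by
    intro f hf
    rw [mem_vanishingIdeal_iff]
    rintro _ ⟨x, rfl⟩
    obtain ⟨N, Q, h1, h2, h3⟩ := key f
    have hN : N = 0 := FaithfulSMul.algebraMap_injective P K (by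
      rw [← h2, RingHom.mem_ker.mp hf]; simp)
    have := h3 x
    rw [hN, map_zero] at this
    exact (mul_eq_zero.mp this).resolve_right (h1 x)
  refine (ringKrullDim_le_of_surjective (Ideal.Quotient.factor hker)
    (Ideal.Quotient.factor_surjective _)).trans ?_
  refine ringKrullDim_le_of_injective (K := K) _ ?_ (Ideal.kerLiftAlg ψ)
    (Ideal.kerLiftAlg_injective ψ)
  have : Algebra.IsAlgebraic P K := IsLocalization.isAlgebraic K (nonZeroDivisors P)
  rw [← trdeg_add_eq ℂ P (A := K), trdeg_eq_zero (R := P) (A := K), add_zero,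
    MvPolynomial.trdeg_of_isDomain]
  simp

end

/-! ### Density of the space of morphisms in affine space. -/

section

open MvPolynomial Filter Topology

/-- The exponent of `y` in the `i`-th form of the morphism `(x^d : x^(d-1) y : … : y^d)`. -/
def monomialExponent (n d : ℕ) (hnd : n ≤ d) (i : Fin (n + 1)) : Fin (d + 1) :=
  if i = Fin.last n then Fin.last d else ⟨i, by omega⟩

theorem monomialExponent_injective {n d : ℕ} (hnd : n ≤ d) :
    Function.Injective (monomialExponent n d hnd) := by
  intro i j h
  unfold monomialExponent at h
  split_ifs at h with h1 h2 h2 <;> simp only [Fin.ext_iff, Fin.val_last] at * <;> omega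

/-- The coefficients of a nondegenerate monomial morphism. -/
def monomialMor (n d : ℕ) (hnd : n ≤ d) : Coeffs n d :=
  fun s => if s.2 = monomialExponent n d hnd s.1 then 1 else 0

theorem norm_formAt_le {n d : ℕ} (b : Coeffs n d) (i : Fin (n + 1)) (x y : ℂ) (r : ℝ)
    (hx : ‖x‖ ≤ r) (hy : ‖y‖ ≤ r) : ‖formAt b i x y‖ ≤ (∑ s, ‖b s‖) * r ^ d := by
  have hr : 0 ≤ r := (norm_nonneg x).trans hx
  have hsum : ∑ j, ‖b (i, j)‖ ≤ ∑ s, ‖b s‖ := by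
    rw [Fintype.sum_prod_type]
    exact Finset.single_le_sum (f := fun i => ∑ j, ‖b (i, j)‖)
      (fun _ _ => Finset.sum_nonneg fun _ _ => norm_nonneg _) (Finset.mem_univ i)
  refine (norm_sum_le _ _).trans ((Finset.sum_le_sum fun j _ => ?_).trans
    ((Finset.sum_mul _ _ _).symm.le.trans (mul_le_mul_of_nonneg_right hsum (by positivity))))
  rw [norm_smul, norm_mul, norm_pow, norm_pow]
  refine mul_le_mul_of_nonneg_left ?_ (norm_nonneg _)
  calc ‖x‖ ^ (d - (j : ℕ)) * ‖y‖ ^ (j : ℕ) ≤ r ^ (d - (j : ℕ)) * r ^ (j : ℕ) := by gcongr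
    _ = r ^ d := by rw [← pow_add]; congr 1; omega

theorem formAt_add_smul {n d : ℕ} (a b : Coeffs n d) (z : ℂ) (i : Fin (n + 1)) (x y : ℂ) :
    formAt (a + z • b) i x y = formAt a i x y + z * formAt b i x y := by
  simp only [formAt, Finset.mul_sum, ← Finset.sum_add_distrib]
  refine Finset.sum_congr rfl fun j _ => ?_
  simp; ring

theorem formAt_monomialMor {n d : ℕ} (hnd : n ≤ d) (i : Fin (n + 1)) (x y : ℂ) :
    formAt (monomialMor n d hnd) i x y =
      x ^ (d - (monomialExponent n d hnd i : ℕ)) * y ^ (monomialExponent n d hnd i : ℕ) := by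
  rw [formAt, Finset.sum_eq_single (monomialExponent n d hnd i)]
  · simp [monomialMor]
  · intro j _ hj; simp [monomialMor, hj]
  · simp

/-- Both x^d and y^d occur among the monomials, so at every point some form has absolute value r^d
with r = max(|x|, |y|), while the perturbation is at most |z| Σ|b_s| r^d. Independence persists
because a maximal minor equals 1 at z = 0. -/
theorem eventually_mem_Mor {n d : ℕ} (hn : 0 < n) (hnd : n ≤ d) (b : Coeffs n d) :
    ∀ᶠ z : ℂ in 𝓝 0, monomialMor n d hnd + z • b ∈ Mor n d := by
  set a := monomialMor n d hnd with ha
  have h1 : ∀ᶠ z : ℂ in 𝓝 0, ‖z‖ * (∑ s, ‖b s‖) < 1 := by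
    have : Continuous fun z : ℂ => ‖z‖ * (∑ s, ‖b s‖) := by fun_prop
    exact this.continuousAt.eventually_lt continuousAt_const (by simp)
  let N : ℂ → Matrix (Fin (n + 1)) (Fin (n + 1)) ℂ :=
    fun z => Matrix.of fun i j => (a + z • b) (i, monomialExponent n d hnd j)
  have h2 : ∀ᶠ z : ℂ in 𝓝 0, (N z).det ≠ 0 := by
    have hc : Continuous fun z : ℂ => (N z).det := by
      refine Continuous.matrix_det (continuous_matrix fun i j => ?_)
      simp only [N, Matrix.of_apply, Pi.add_apply, Pi.smul_apply]
      fun_prop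
    refine hc.continuousAt.eventually_ne ?_
    have : N 0 = 1 := by
      ext i j
      simp [N, a, monomialMor, Matrix.one_apply, (monomialExponent_injective hnd).eq_iff, eq_comm]
    simp [this]
  filter_upwards [h1, h2] with z hz1 hz2
  refine ⟨fun v hv h0 => ?_, ?_⟩
  · have key : ∀ (i : Fin (n + 1)) (r : ℝ), ‖v 0‖ ≤ r → ‖v 1‖ ≤ r → 0 < r →
        ‖formAt a i (v 0) (v 1)‖ ≠ r ^ d := by
      intro i r hx hy hr he
      have h3 : formAt a i (v 0) (v 1) + z * formAt b i (v 0) (v 1) = 0 := by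
        rw [← formAt_add_smul]; exact congrFun h0 i
      have h4 : ‖formAt a i (v 0) (v 1)‖ = ‖z‖ * ‖formAt b i (v 0) (v 1)‖ := by
        rw [eq_neg_of_add_eq_zero_left h3, norm_neg, norm_mul]
      have h5 := norm_formAt_le b i (v 0) (v 1) r hx hy
      have h6 : 0 < r ^ d := by positivity
      have h7 := mul_le_mul_of_nonneg_left h5 (norm_nonneg z)
      nlinarith
    have hpos : 0 < ‖v 0‖ ∨ 0 < ‖v 1‖ := by
      by_contra! hc
      refine hv (funext fun i => ?_)
      fin_cases i
      · exact norm_le_zero_iff.mp hc.1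
      · exact norm_le_zero_iff.mp hc.2
    rcases le_total ‖v 1‖ ‖v 0‖ with h | h
    · refine key 0 ‖v 0‖ le_rfl h (hpos.elim id fun h' => h'.trans_le h) ?_
      have : (monomialExponent n d hnd 0 : ℕ) = 0 := by
        rw [monomialExponent, if_neg]
        · rfl
        · intro h; simp [Fin.ext_iff] at h; omega
      rw [ha, formAt_monomialMor, this]; simp
    · refine key (Fin.last n) ‖v 1‖ h le_rfl (hpos.elim (fun h' => h'.trans_le h) id) ?_
      rw [ha, formAt_monomialMor]; simp [monomialExponent]
  · refine LinearIndependent.of_comp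
      (LinearMap.funLeft ℂ ℂ (monomialExponent n d hnd)) ?_
    exact Matrix.linearIndependent_rows_of_det_ne_zero hz2

/-- On the complex line from the monomial morphism to an arbitrary point `c`, the polynomial has
infinitely many zeros near the start; so it vanishes on the line, in particular at `c`. -/
theorem eq_zero_of_eval_Mor {n d : ℕ} (hn : 0 < n) (hnd : n ≤ d)
    (p : MvPolynomial (Fin (n + 1) × Fin (d + 1)) ℂ) (hp : ∀ x ∈ Mor n d, eval x p = 0) :
    p = 0 := by
  refine MvPolynomial.funext fun c => ?_
  rw [map_zero]
  set a := monomialMor n d hnd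
  let q : Polynomial ℂ :=
    aeval (fun s => Polynomial.C (a s) + Polynomial.X * Polynomial.C ((c - a) s)) p
  have hq : ∀ z, q.eval z = eval (a + z • (c - a)) p := by
    intro z
    rw [← Polynomial.coe_evalRingHom, ← aeval_eq_eval]
    change ((Polynomial.aeval z : Polynomial ℂ →ₐ[ℂ] ℂ).comp (aeval _)) p = aeval _ p
    congr 1
    ext s
    simp
  have h0 : q = 0 := by
    refine Polynomial.eq_zero_of_infinite_isRoot q ?_
    have hev := eventually_mem_Mor hn hnd (c - a)
    refine (infinite_of_mem_nhds (0 : ℂ) hev).mono fun z hz => ?_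
    change q.eval z = 0
    rw [hq]; exact hp _ hz
  have := hq 1
  rw [h0] at this
  simpa using this.symm

theorem zariskiDim_Mor {n d : ℕ} (hn : 0 < n) (hnd : n ≤ d) :
    zariskiDim (Mor n d) = ((n + 1) * (d + 1) : ℕ) := by
  rw [zariskiDim_eq_card (eq_zero_of_eval_Mor hn hnd)]
  simp

end

/-! ### Local algebra at a hyperelliptic cusp. -/

section

open PowerSeries

/-- The set of orders of the nonzero linear combinations of a family of power series. -/
def orderSet {n : ℕ} (E : Fin (n + 1) → PowerSeries ℂ) : Set ℕ :=
  {m | ∃ c : Fin (n + 1) → ℂ, (∑ i, c i • E i).order = (m : ℕ∞)}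

/-- Up to a common unit factor, the power series `E i` lie in a subring without elements of
odd order less than `2 g + 1`, and linear combinations of order `0` and of order `2` exist. -/
def IsCuspidal {n : ℕ} (g : ℕ) (E : Fin (n + 1) → PowerSeries ℂ) : Prop :=
  (∃ (O : Subalgebra ℂ (PowerSeries ℂ)) (e : PowerSeries ℂ), constantCoeff e ≠ 0 ∧
    (∀ f ∈ O, constantCoeff f ≠ 0 → f⁻¹ ∈ O) ∧
    (∀ f ∈ O, ∀ r < g, f.order ≠ ((2 * r + 1 : ℕ) : ℕ∞)) ∧
    ∀ i, ∃ f ∈ O, E i = e * f) ∧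
  0 ∈ orderSet E ∧ 2 ∈ orderSet E

theorem hyperellipticSemigroup_even_or_le {g m : ℕ} (h : m ∈ hyperellipticSemigroup g) :
    Even m ∨ 2 * g + 1 ≤ m := by
  refine AddSubmonoid.closure_induction (motive := fun m _ => Even m ∨ 2 * g + 1 ≤ m) ?_ ?_ ?_ h
  · rintro x (rfl | rfl)
    · exact Or.inl even_two
    · exact Or.inr le_rfl
  · exact Or.inl Even.zero
  · rintro x y - - (hx | hx) (hy | hy)
    · exact Or.inl (hx.add hy)
    all_goals right; omega

theorem order_eq_zero_of_constantCoeff {f : PowerSeries ℂ} (h : constantCoeff f ≠ 0) :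
    f.order = 0 := by
  by_contra h0
  exact h (order_ne_zero_iff_constCoeff_eq_zero.mp h0)

theorem constantCoeff_expansion {n d : ℕ} (a : Coeffs n d) (v w : Fin 2 → ℂ) (i : Fin (n + 1)) :
    constantCoeff (expansion a v w i) = evalAt a v i := by
  simp [expansion, evalAt, formAt]

theorem expansion_eq_mul_localSection {n d : ℕ} {a : Coeffs n d} {v w : Fin 2 → ℂ}
    {j : Fin (n + 1)} (h : IsLocalChart a v w j) (i : Fin (n + 1)) :
    expansion a v w i = expansion a v w j * localSection a v w j i := by
  have h0 : constantCoeff (expansion a v w j) ≠ 0 := by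
    rw [constantCoeff_expansion]; exact h.2
  rw [localSection, mul_left_comm, PowerSeries.mul_inv_cancel _ h0, mul_one]

theorem order_sum_expansion {n d : ℕ} {a : Coeffs n d} {v w : Fin 2 → ℂ}
    {j : Fin (n + 1)} (h : IsLocalChart a v w j) (c : Fin (n + 1) → ℂ) :
    (∑ i, c i • expansion a v w i).order = (∑ i, c i • localSection a v w j i).order := by
  have h0 : constantCoeff (expansion a v w j) ≠ 0 := by
    rw [constantCoeff_expansion]; exact h.2
  have : ∑ i, c i • expansion a v w i =
      expansion a v w j * ∑ i, c i • localSection a v w j i := by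
    rw [Finset.mul_sum]
    refine Finset.sum_congr rfl fun i _ => ?_
    rw [mul_smul_comm, ← expansion_eq_mul_localSection h]
  rw [this, order_mul, order_eq_zero_of_constantCoeff h0, zero_add]

theorem vanishingOrders_eq_orderSet {n d : ℕ} {a : Coeffs n d} {v w : Fin 2 → ℂ}
    {j : Fin (n + 1)} (h : IsLocalChart a v w j) :
    vanishingOrders a v w j = orderSet (expansion a v w) := by
  ext m
  simp only [vanishingOrders, orderSet, order_sum_expansion h]

/-- Every nonconstant monomial is sent into the ideal (t^(m+1)), so only the constant term of `h`
contributes at t^m. -/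
theorem coeff_localHom {n d : ℕ} (a : Coeffs n d) (v w : Fin 2 → ℂ) (j : Fin (n + 1)) (m : ℕ)
    (hm : ∀ i, X ^ (m + 1) ∣ localCoord a v w j i) (h : MvPowerSeries (Fin n) ℂ) :
    coeff m (localHom a v w j h) =
      MvPowerSeries.coeff 0 h * coeff m (1 : PowerSeries ℂ) := by
  have h1 : coeff m (localHom a v w j h) = MvPowerSeries.coeff (Finsupp.single () m)
      (MvPowerSeries.subst (localCoord a v w j) h) := by
    rw [localHom, MvPowerSeries.coe_substAlgHom]; rfl
  rw [h1, MvPowerSeries.coeff_subst (hasSubst_localCoord a v w j), finsum_eq_single _ 0]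
  · simp only [Finsupp.prod_zero_index, smul_eq_mul]; rfl
  · intro e he
    obtain ⟨i, hi⟩ := Finsupp.support_nonempty_iff.mpr he
    have hdvd : X ^ (m + 1) ∣ (e.prod fun s k => localCoord a v w j s ^ k : PowerSeries ℂ) := by
      refine (hm i).trans (dvd_trans (dvd_pow_self _ (Finsupp.mem_support_iff.mp hi)) ?_)
      exact Finset.dvd_prod_of_mem (fun s => localCoord a v w j s ^ e s) hi
    have := (X_pow_dvd_iff.mp hdvd) m (Nat.lt_succ_self m)
    rw [smul_eq_mul]
    exact mul_eq_zero_of_right _ this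

theorem localSection_mem_range {n d : ℕ} {a : Coeffs n d} {v w : Fin 2 → ℂ}
    {j : Fin (n + 1)} (h : IsLocalChart a v w j) (i : Fin (n + 1)) :
    localSection a v w j i ∈ (localHom a v w j).range := by
  rcases Fin.eq_self_or_eq_succAbove j i with rfl | ⟨i, rfl⟩
  · have h0 : constantCoeff (expansion a v w i) ≠ 0 := by
      rw [constantCoeff_expansion]; exact h.2
    rw [localSection, PowerSeries.mul_inv_cancel _ h0]
    exact one_mem _
  · have h1 : localCoord a v w j i ∈ (localHom a v w j).range := by
      refine ⟨MvPowerSeries.X i, ?_⟩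
      change localHom a v w j (MvPowerSeries.X i) = _
      rw [localHom, MvPowerSeries.coe_substAlgHom,
        MvPowerSeries.subst_X (hasSubst_localCoord a v w j)]
    have h2 : C (constantCoeff (localSection a v w j (j.succAbove i))) ∈
        (localHom a v w j).range := Subalgebra.algebraMap_mem _ _
    have := add_mem h1 h2
    rwa [localCoord, sub_add_cancel] at this

/-- The subring is the image of `localHom`, and the unit is the expansion of the form that does not
vanish at the point. -/
theorem isCuspidal_expansion {n d g : ℕ} (hg : 0 < g) {a : Coeffs n d} {v w : Fin 2 → ℂ}
    {j : Fin (n + 1)} (h : IsLocalChart a v w j)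
    (hS : valueSemigroup a v w j = hyperellipticSemigroup g) :
    IsCuspidal g (expansion a v w) := by
  have h0 : constantCoeff (expansion a v w j) ≠ 0 := by
    rw [constantCoeff_expansion]; exact h.2
  have hodd : ∀ f ∈ (localHom a v w j).range, ∀ r < g, f.order ≠ ((2 * r + 1 : ℕ) : ℕ∞) := by
    rintro _ ⟨x, rfl⟩ r hr he
    have hmem : 2 * r + 1 ∈ valueSemigroup a v w j := ⟨x, he⟩
    rw [hS] at hmem
    rcases hyperellipticSemigroup_even_or_le hmem with h | h
    · exact (Nat.not_even_iff_odd.mpr ⟨r, rfl⟩) h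
    · omega
  refine ⟨⟨(localHom a v w j).range, expansion a v w j, h0, ?_, hodd, fun i =>
    ⟨_, localSection_mem_range h i, expansion_eq_mul_localSection h i⟩⟩, ?_, ?_⟩
  · rintro _ ⟨x, rfl⟩ hx
    change constantCoeff (localHom a v w j x) ≠ 0 at hx
    have hc : MvPowerSeries.constantCoeff x ≠ 0 := by
      intro hc
      refine hx ?_
      rw [← coeff_zero_eq_constantCoeff_apply, coeff_localHom a v w j 0 fun i => ?_]
      · rw [MvPowerSeries.coeff_zero_eq_constantCoeff_apply, hc, zero_mul]
      · rw [zero_add, pow_one, X_dvd_iff]; simp [localCoord]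
    refine ⟨x⁻¹, ?_⟩
    change localHom a v w j x⁻¹ = (localHom a v w j x)⁻¹
    rw [PowerSeries.eq_inv_iff_mul_eq_one hx, ← map_mul, MvPowerSeries.inv_mul_cancel _ hc,
      map_one]
  · refine ⟨Pi.single j 1, ?_⟩
    rw [Finset.sum_eq_single j (fun i _ hi => by simp [hi]) (by simp)]
    simp only [Pi.single_eq_same, one_smul]
    exact order_eq_zero_of_constantCoeff h0
  -- Order 1 is excluded since g ≥ 1. If order 2 did not occur either, all local coordinates would
  -- be divisible by t^3, and no element of the local ring could have valuation 2.
  · by_contra h2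
    have hcoord : ∀ i, X ^ 3 ∣ localCoord a v w j i := by
      intro i
      obtain ⟨c, hc⟩ : ∃ c : Fin (n + 1) → ℂ,
          localCoord a v w j i = ∑ l, c l • localSection a v w j l := by
        have hj : localSection a v w j j = 1 := by
          rw [localSection, PowerSeries.mul_inv_cancel _ h0]
        refine ⟨Pi.single (j.succAbove i) 1 - Pi.single j
          (constantCoeff (localSection a v w j (j.succAbove i))), ?_⟩
        simp only [Pi.sub_apply, sub_smul, Finset.sum_sub_distrib]
        rw [Finset.sum_eq_single (j.succAbove i) (fun i _ hi => by simp [hi]) (by simp),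
          Finset.sum_eq_single j (fun i _ hi => by simp [hi]) (by simp)]
        simp only [Pi.single_eq_same, one_smul, hj, localCoord]
        rw [smul_eq_C_mul, mul_one]
      have hmem : localCoord a v w j i ∈ (localHom a v w j).range := by
        rw [hc]
        exact Subalgebra.sum_mem _ fun l _ =>
          Subalgebra.smul_mem _ (localSection_mem_range h l) _
      have hc0 : coeff 0 (localCoord a v w j i) = 0 := by simp [localCoord]
      have hc1 : coeff 1 (localCoord a v w j i) = 0 := by
        by_contra hne
        refine hodd _ hmem 0 hg (order_eq_nat.mpr ⟨hne, fun l hl => ?_⟩)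
        obtain rfl : l = 0 := by omega
        exact hc0
      rw [X_pow_dvd_iff]
      intro l hl
      interval_cases l
      · exact hc0
      · exact hc1
      · by_contra hne
        refine h2 ⟨c, ?_⟩
        rw [order_sum_expansion h, ← hc]
        refine order_eq_nat.mpr ⟨hne, fun l hl => ?_⟩
        interval_cases l
        · exact hc0
        · exact hc1
    have hmem : 2 ∈ valueSemigroup a v w j := by
      rw [hS]
      exact AddSubmonoid.subset_closure (Or.inl rfl)
    obtain ⟨x, hx⟩ := hmem
    refine (order_eq_nat.mp hx).1 ?_
    rw [coeff_localHom a v w j 2 hcoord, coeff_one]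
    simp

end

/-! ### Change of the local parameter and its normalization. -/

section

open PowerSeries

theorem map_formAt {n d : ℕ} (a : Coeffs n d) {A B : Type} [CommRing A] [Algebra ℂ A]
    [CommRing B] [Algebra ℂ B] (φ : A →ₐ[ℂ] B) (i : Fin (n + 1)) (x y : A) :
    φ (formAt a i x y) = formAt a i (φ x) (φ y) := by
  simp [formAt]

theorem formAt_mul {n d : ℕ} (a : Coeffs n d) {A : Type} [CommRing A] [Algebra ℂ A]
    (i : Fin (n + 1)) (c x y : A) :
    formAt a i (c * x) (c * y) = c ^ d * formAt a i x y := by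
  simp only [formAt, Finset.mul_sum]
  refine Finset.sum_congr rfl fun j _ => ?_
  rw [mul_smul_comm]
  congr 1
  have : c ^ d = c ^ (d - (j : ℕ)) * c ^ (j : ℕ) := by rw [← pow_add]; congr 1; omega
  rw [this, mul_pow, mul_pow]; ring

/-- A change of the local parameter. -/
theorem exists_substitution (τ : PowerSeries ℂ) (hτ : τ.order = 1) :
    ∃ φ : PowerSeries ℂ →ₐ[ℂ] PowerSeries ℂ, φ X = τ ∧
      (∀ f, constantCoeff (φ f) = constantCoeff f) ∧ ∀ f, (φ f).order = f.order := by
  have h0 : constantCoeff τ = 0 := by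
    refine order_ne_zero_iff_constCoeff_eq_zero.mp ?_
    rw [hτ]; exact one_ne_zero
  have hs : HasSubst τ := HasSubst.of_constantCoeff_zero' h0
  let φ : PowerSeries ℂ →ₐ[ℂ] PowerSeries ℂ := substAlgHom hs
  have hX : φ X = τ := substAlgHom_X hs
  have hC : ∀ f, constantCoeff (φ f) = constantCoeff f := by
    intro f
    have h1 : φ (C (constantCoeff f)) = C (constantCoeff f) := φ.commutes _
    conv_lhs => rw [eq_X_mul_shift_add_const f, map_add, map_mul, h1, hX]
    simp [h0]
  refine ⟨φ, hX, hC, fun f => ?_⟩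
  rcases eq_or_ne f 0 with rfl | hf
  · simp
  conv_lhs => rw [← X_pow_order_mul_divXPowOrder (f := f)]
  rw [map_mul, map_pow, hX, order_mul, order_pow, hτ,
    order_eq_zero_of_constantCoeff (f := φ _)]
  · simp [coe_toNat_order hf]
  · rw [hC, constantCoeff_divXPowOrder]
    exact coeff_order hf

/-- One has r v + X (s v + t w) = κ (v + τ w) with κ = r + sX and τ = tX/κ. Homogeneity turns the
factor κ into κ^d, and what remains is the substitution X ↦ τ. -/
theorem expansion_change {n d : ℕ} (a : Coeffs n d) (v w : Fin 2 → ℂ) (r s t : ℂ) (hr : r ≠ 0)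
    (ht : t ≠ 0) : ∃ (φ : PowerSeries ℂ →ₐ[ℂ] PowerSeries ℂ) (κ : PowerSeries ℂ),
      constantCoeff κ ≠ 0 ∧ (∀ f, constantCoeff (φ f) = constantCoeff f) ∧
      (∀ f, (φ f).order = f.order) ∧
      ∀ i, expansion a (r • v) (s • v + t • w) i = κ * φ (expansion a v w i) := by
  let κ : PowerSeries ℂ := C r + C s * X
  have hκ : constantCoeff κ ≠ 0 := by simpa [κ] using hr
  let τ : PowerSeries ℂ := C t * X * κ⁻¹
  have hτ : τ.order = 1 := by
    rw [order_mul, order_mul, order_X, order_eq_zero_of_constantCoeff,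
      order_eq_zero_of_constantCoeff]
    · simp
    · simpa using hκ
    · simpa using ht
  have hκτ : κ * τ = C t * X := by
    rw [mul_left_comm, PowerSeries.mul_inv_cancel _ hκ, mul_one]
  obtain ⟨φ, hX, hC, ho⟩ := exists_substitution τ hτ
  refine ⟨φ, κ ^ d, by simpa using fun h => (hκ h).elim, hC, ho, fun i => ?_⟩
  have hc : ∀ c : ℂ, φ (C c) = C c := φ.commutes
  rw [expansion, expansion, map_formAt, ← formAt_mul]
  congr 1
  all_goals
    simp only [map_add, map_mul, hc, hX, Pi.smul_apply, Pi.add_apply, smul_eq_mul, mul_add]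
    rw [mul_left_comm κ, hκτ]
    simp only [κ]
    ring

theorem orderSet_change {n : ℕ} {E E' : Fin (n + 1) → PowerSeries ℂ}
    (φ : PowerSeries ℂ →ₐ[ℂ] PowerSeries ℂ) (κ : PowerSeries ℂ) (hκ : constantCoeff κ ≠ 0)
    (ho : ∀ f, (φ f).order = f.order) (hE : ∀ i, E' i = κ * φ (E i)) :
    orderSet E' = orderSet E := by
  have : ∀ c : Fin (n + 1) → ℂ, (∑ i, c i • E' i).order = (∑ i, c i • E i).order := by
    intro c
    have : ∑ i, c i • E' i = κ * φ (∑ i, c i • E i) := by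
      rw [map_sum, Finset.mul_sum]
      refine Finset.sum_congr rfl fun i _ => ?_
      rw [hE, map_smul, mul_smul_comm]
    rw [this, order_mul, ho, order_eq_zero_of_constantCoeff hκ, zero_add]
  ext m
  simp only [orderSet, this]

theorem IsCuspidal.change {n g : ℕ} {E E' : Fin (n + 1) → PowerSeries ℂ}
    (h : IsCuspidal g E) (φ : PowerSeries ℂ →ₐ[ℂ] PowerSeries ℂ) (κ : PowerSeries ℂ)
    (hκ : constantCoeff κ ≠ 0) (hC : ∀ f, constantCoeff (φ f) = constantCoeff f)
    (ho : ∀ f, (φ f).order = f.order) (hE : ∀ i, E' i = κ * φ (E i)) :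
    IsCuspidal g E' := by
  obtain ⟨⟨O, e, he, hinv, hodd, hmem⟩, h0, h2⟩ := h
  rw [← orderSet_change φ κ hκ ho hE] at h0 h2
  refine ⟨⟨O.map φ, κ * φ e, ?_, ?_, ?_, ?_⟩, h0, h2⟩
  · rw [map_mul, hC]; exact mul_ne_zero hκ he
  · rintro _ ⟨f, hf, rfl⟩ hf0
    change constantCoeff (φ f) ≠ 0 at hf0
    refine ⟨f⁻¹, hinv f hf (by rwa [hC] at hf0), ?_⟩
    change φ f⁻¹ = (φ f)⁻¹
    rw [PowerSeries.eq_inv_iff_mul_eq_one hf0, ← map_mul,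
      PowerSeries.inv_mul_cancel _ (by rwa [hC] at hf0), map_one]
  · rintro _ ⟨f, hf, rfl⟩ r hr
    change (φ f).order ≠ _
    rw [ho]
    exact hodd f hf r hr
  · intro i
    obtain ⟨f, hf, hEf⟩ := hmem i
    exact ⟨φ f, ⟨f, hf, rfl⟩, by rw [hE, hEf, map_mul, mul_assoc]⟩

/-- The coefficient of `x^(d-j) y^j` in the form whose expansion is `t^l`, with respect to the
basis `(1, θ)`, `(0, 1)` of `ℂ²` (or `(0, 1)`, `(1, 0)` for the point at infinity). -/
def chartCoeff (d : ℕ) (infinity : Bool) (j : Fin (d + 1)) (l : ℕ) (θ : ℂ) : ℂ :=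
  if infinity then (if l = d - j then 1 else 0) else (-θ) ^ (l - (j : ℕ)) * (l.choose j : ℂ)

/-- At x = 1 the form is a polynomial P in y and its expansion is P(θ + t); expanding the powers of
y - θ recovers P. -/
theorem expansion_finite {n d : ℕ} (a : Coeffs n d) (θ : ℂ) (i : Fin (n + 1)) :
    (∀ l, d < l → coeff l (expansion a ![1, θ] ![0, 1] i) = 0) ∧
    ∀ j, a (i, j) = ∑ l ∈ Finset.range (d + 1),
      coeff l (expansion a ![1, θ] ![0, 1] i) * chartCoeff d false j l θ := by
  let P : Polynomial ℂ := ∑ j : Fin (d + 1), Polynomial.monomial (j : ℕ) (a (i, j))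
  have hPd : P.natDegree < d + 1 := by
    refine Nat.lt_succ_of_le (Polynomial.natDegree_sum_le_of_forall_le _ _ fun j _ => ?_)
    exact (Polynomial.natDegree_monomial_le _).trans (by omega)
  have hPc : ∀ j : Fin (d + 1), P.coeff j = a (i, j) := by
    intro j
    simp only [P, Polynomial.finsetSum_coeff, Polynomial.coeff_monomial]
    rw [Finset.sum_eq_single j]
    · simp
    · intro b _ hb; rw [if_neg]; exact fun h => hb (Fin.ext h)
    · simp
  have hE : expansion a ![1, θ] ![0, 1] i = (Polynomial.taylor θ P : Polynomial ℂ) := by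
    simp only [P, expansion, formAt, map_sum, Polynomial.taylor_monomial]
    rw [← Polynomial.coeToPowerSeries.ringHom_apply, map_sum]
    refine Finset.sum_congr rfl fun j _ => ?_
    simp [smul_eq_C_mul, add_comm]
  have hcoef : ∀ l, coeff l (expansion a ![1, θ] ![0, 1] i) = (Polynomial.taylor θ P).coeff l := by
    intro l; rw [hE, Polynomial.coeff_coe]
  have hdeg : (Polynomial.taylor θ P).natDegree < d + 1 := by
    rwa [Polynomial.natDegree_taylor]
  refine ⟨fun l hl => ?_, fun j => ?_⟩
  · rw [hcoef]
    exact Polynomial.coeff_eq_zero_of_natDegree_lt (by omega)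
  · have h1 := Polynomial.sum_taylor_eq P θ
    rw [Polynomial.sum_over_range' _ (by simp) (d + 1) hdeg] at h1
    rw [← hPc, ← h1, Polynomial.finsetSum_coeff]
    refine Finset.sum_congr rfl fun l _ => ?_
    -- The truncated exponent `l - j` in `chartCoeff` is harmless: for l < j the binomial
    -- coefficient is zero.
    rw [Polynomial.coeff_C_mul, sub_eq_add_neg, ← map_neg, Polynomial.coeff_X_add_C_pow, hcoef, chartCoeff]
    simp

theorem expansion_infinity {n d : ℕ} (a : Coeffs n d) (i : Fin (n + 1)) :
    (∀ l, d < l → coeff l (expansion a ![0, 1] ![1, 0] i) = 0) ∧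
    ∀ j, a (i, j) = ∑ l ∈ Finset.range (d + 1),
      coeff l (expansion a ![0, 1] ![1, 0] i) * chartCoeff d true j l 0 := by
  have hcoef : ∀ l, coeff l (expansion a ![0, 1] ![1, 0] i) =
      ∑ j : Fin (d + 1), if l = d - j then a (i, j) else 0 := by
    intro l
    simp [expansion, formAt, coeff_X_pow]
  refine ⟨fun l hl => ?_, fun j => ?_⟩
  · rw [hcoef]
    exact Finset.sum_eq_zero fun j _ => if_neg (by omega)
  · rw [Finset.sum_eq_single (d - j : ℕ)]
    · rw [hcoef, Finset.sum_eq_single j]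
      · simp [chartCoeff]
      · intro b _ hb; rw [if_neg]; intro h; exact hb (Fin.ext (by omega))
      · simp
    · intro l _ hl; simp [chartCoeff, hl]
    · intro h; exact absurd (Finset.mem_range.mpr (by omega)) h

/-- A morphism with a hyperelliptic cusp, in a normalized local parameter at the cusp. -/
theorem exists_normalized_expansion {n d g : ℕ} (hg : 0 < g) {a : Coeffs n d} {v w : Fin 2 → ℂ}
    {j : Fin (n + 1)} (h : IsLocalChart a v w j)
    (hS : valueSemigroup a v w j = hyperellipticSemigroup g) :
    ∃ (b : Bool) (θ : ℂ) (E : Fin (n + 1) → PowerSeries ℂ), IsCuspidal g E ∧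
      orderSet E = vanishingOrders a v w j ∧ (∀ i l, d < l → coeff l (E i) = 0) ∧
      ∀ i j, a (i, j) =
        ∑ l ∈ Finset.range (d + 1), coeff l (E i) * chartCoeff d b j l θ := by
  have hcusp := isCuspidal_expansion hg h hS
  rw [vanishingOrders_eq_orderSet h]
  have hD := h.1
  -- Rescaling `v` and replacing `w` by a combination of `v` and `w` reaches the basis (1, θ), (0,
  -- 1), or (0, 1), (1, 0) at infinity. Only θ survives as a parameter.
  by_cases hv : v 0 = 0
  · have hv1 : v 1 ≠ 0 := fun h1 => hD (by simp [hv, h1])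
    have hw0 : w 0 ≠ 0 := fun h1 => hD (by simp [hv, h1])
    obtain ⟨φ, κ, hκ, hC, ho, hE⟩ := expansion_change a v w (v 1)⁻¹ (-(w 1 / (w 0 * v 1)))
      (w 0)⁻¹ (inv_ne_zero hv1) (inv_ne_zero hw0)
    have e1 : (v 1)⁻¹ • v = ![0, 1] := by
      funext i; fin_cases i
      · simp [hv]
      · simp [hv1]
    have e2 : (-(w 1 / (w 0 * v 1))) • v + (w 0)⁻¹ • w = ![1, 0] := by
      funext i; fin_cases i
      · simp [hv, hw0]
      · simp; field_simp; ring
    rw [e1, e2] at hE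
    exact ⟨true, 0, _, hcusp.change φ κ hκ hC ho hE, orderSet_change φ κ hκ ho hE,
      fun i => (expansion_infinity a i).1, fun i => (expansion_infinity a i).2⟩
  · set D := v 0 * w 1 - v 1 * w 0 with hDdef
    obtain ⟨φ, κ, hκ, hC, ho, hE⟩ := expansion_change a v w (v 0)⁻¹ (-(w 0 / D))
      (v 0 / D) (inv_ne_zero hv) (div_ne_zero hv hD)
    have e1 : (v 0)⁻¹ • v = ![1, v 1 / v 0] := by
      funext i; fin_cases i
      · simp [hv]
      · simp [div_eq_inv_mul]
    have e2 : (-(w 0 / D)) • v + (v 0 / D) • w = ![0, 1] := by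
      funext i; fin_cases i
      · simp; ring
      · simp; field_simp; rw [hDdef]; ring
    rw [e1, e2] at hE
    exact ⟨false, v 1 / v 0, _, hcusp.change φ κ hκ hC ho hE, orderSet_change φ κ hκ ho hE,
      fun i => (expansion_finite a _ i).1, fun i => (expansion_finite a _ i).2⟩

end

/-! ### Vanishing orders, echelon form and the relation modulo t^(2g). -/

section

open PowerSeries

/-- A nonzero combination has a nonzero coefficient at its own order, so the coefficients at the
occurring orders separate combinations: there are at least n+1 orders. Combinations with distinct
orders form a triangular system, so there are at most n+1. -/
theorem exists_orderSet_eq_range {n d : ℕ} {E : Fin (n + 1) → PowerSeries ℂ}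
    (hE : LinearIndependent ℂ E) (hd : ∀ i l, d < l → coeff l (E i) = 0) :
    ∃ k : Fin (n + 1) → ℕ, StrictMono k ∧ orderSet E = Set.range k := by
  classical
  have hbound : ∀ m ∈ orderSet E, m ≤ d := by
    rintro m ⟨c, hc⟩
    by_contra hm
    refine (order_eq_nat.mp hc).1 ?_
    rw [map_sum]
    exact Finset.sum_eq_zero fun i _ => by rw [coeff_smul, hd i m (by omega), smul_zero]
  have hfin : (orderSet E).Finite := (Set.finite_Iic d).subset hbound
  let K := hfin.toFinset
  have hK : ∀ m, m ∈ K ↔ m ∈ orderSet E := fun m => hfin.mem_toFinset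
  have h1 : n + 1 ≤ K.card := by
    let L : (Fin (n + 1) → ℂ) →ₗ[ℂ] (K → ℂ) :=
      (LinearMap.pi fun m : K => coeff (R := ℂ) (m : ℕ)) ∘ₗ Fintype.linearCombination ℂ E
    have hL : Function.Injective L := by
      rw [← LinearMap.ker_eq_bot, LinearMap.ker_eq_bot']
      intro c hc
      have hzero : ∑ i, c i • E i = 0 := by
        by_contra hne
        have hm : (∑ i, c i • E i).order.toNat ∈ K :=
          (hK _).mpr ⟨c, (coe_toNat_order hne).symm⟩
        refine coeff_order hne ?_
        have := congrFun hc ⟨_, hm⟩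
        simpa [L, Fintype.linearCombination_apply] using this
      exact funext (Fintype.linearIndependent_iff.mp hE c hzero)
    have := LinearMap.finrank_le_finrank_of_injective hL
    simpa using this
  have h2 : K.card ≤ n + 1 := by
    let k := K.orderEmbOfFin rfl
    have hk : ∀ i, ∃ c : Fin (n + 1) → ℂ, (∑ l, c l • E l).order = (k i : ℕ∞) :=
      fun i => (hK _).mp (K.orderEmbOfFin_mem rfl i)
    choose c hc using hk
    let M : Matrix (Fin K.card) (Fin K.card) ℂ :=
      Matrix.of fun i j => coeff (k j) (∑ l, c i l • E l)
    have hM : M.det ≠ 0 := by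
      rw [Matrix.det_of_isUpperTriangular]
      · exact Finset.prod_ne_zero_iff.mpr fun i _ => (order_eq_nat.mp (hc i)).1
      · intro i j hij
        exact (order_eq_nat.mp (hc i)).2 _ (k.strictMono hij)
    let L : (Fin (n + 1) → ℂ) →ₗ[ℂ] (Fin K.card → ℂ) :=
      (LinearMap.pi fun j => coeff (R := ℂ) (k j)) ∘ₗ Fintype.linearCombination ℂ E
    have hcomp : LinearIndependent ℂ (L ∘ c) := by
      have hrow : L ∘ c = M.row := by
        funext i j
        simp [L, M, Fintype.linearCombination_apply]
      rw [hrow]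
      exact Matrix.linearIndependent_rows_of_det_ne_zero hM
    simpa using (LinearIndependent.of_comp L hcomp).fintype_card_le_finrank
  refine ⟨K.orderEmbOfFin (le_antisymm h2 h1), OrderEmbedding.strictMono _, ?_⟩
  rw [Finset.range_orderEmbOfFin]
  ext m
  simp [K]

/-- The reduced echelon form of a linearly independent family of power series. -/
theorem exists_echelon {n : ℕ} {E : Fin (n + 1) → PowerSeries ℂ} {k : Fin (n + 1) → ℕ}
    (hE : LinearIndependent ℂ E) (hkE : orderSet E = Set.range k) :
    ∃ (A B : Matrix (Fin (n + 1)) (Fin (n + 1)) ℂ) (G : Fin (n + 1) → PowerSeries ℂ),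
      (∀ i, E i = ∑ l, A i l • G l) ∧ (∀ i, G i = ∑ l, B i l • E l) ∧
      (∀ i l, coeff (k l) (G i) = if l = i then 1 else 0) ∧
      ∀ i, ∀ l < k i, coeff l (G i) = 0 := by
  -- The matrix of coefficients at the orders is invertible: a combination killed at all of them
  -- would have an order outside `Set.range k`. The echelon form is its inverse applied to `E`.
  let N : Matrix (Fin (n + 1)) (Fin (n + 1)) ℂ := Matrix.of fun i l => coeff (k l) (E i)
  have hN : IsUnit N := by
    rw [← Matrix.vecMul_injective_iff_isUnit]
    rw [← Matrix.coe_vecMulLinear, ← LinearMap.ker_eq_bot, LinearMap.ker_eq_bot']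
    intro c hc
    have hzero : ∑ i, c i • E i = 0 := by
      by_contra hne
      obtain ⟨l, hl⟩ : (∑ i, c i • E i).order.toNat ∈ Set.range k := by
        rw [← hkE]; exact ⟨c, (coe_toNat_order hne).symm⟩
      refine coeff_order hne ?_
      rw [← hl]
      have := congrFun hc l
      simpa [N, Matrix.vecMul, dotProduct] using this
    exact funext (Fintype.linearIndependent_iff.mp hE c hzero)
  have hdet : IsUnit N.det := (Matrix.isUnit_iff_isUnit_det N).mp hN
  have hpivot : ∀ i l, coeff (k l) (∑ m, N⁻¹ i m • E m) = if l = i then 1 else 0 := by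
    intro i l
    have : (N⁻¹ * N) i l = if l = i then 1 else 0 := by
      rw [Matrix.nonsing_inv_mul _ hdet, Matrix.one_apply]
      simp [eq_comm]
    rw [← this, Matrix.mul_apply]
    simp [N]
  refine ⟨N, N⁻¹, fun i => ∑ l, N⁻¹ i l • E l, fun i => ?_, fun i => rfl, hpivot, ?_⟩
  · simp_rw [Finset.smul_sum, smul_smul]
    rw [Finset.sum_comm]
    simp_rw [← Finset.sum_smul, ← Matrix.mul_apply, Matrix.mul_nonsing_inv _ hdet,
      Matrix.one_apply]
    simp
  · intro i l hl
    have hne : ∑ m, N⁻¹ i m • E m ≠ 0 := by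
      intro h0
      have := hpivot i i
      rw [h0] at this
      simp at this
    obtain ⟨m, hm⟩ : (∑ m, N⁻¹ i m • E m).order.toNat ∈ Set.range k := by
      rw [← hkE]; exact ⟨_, (coe_toNat_order hne).symm⟩
    have h1 := coeff_order hne
    rw [← hm, hpivot] at h1
    obtain rfl : m = i := by by_contra h; simp [h] at h1
    exact coeff_of_lt_order_toNat _ (by rw [← hm]; exact hl)

/-- Modulo `t^(2g)`, a section of a cuspidal family is a polynomial in the quotient of a section
of order `2` by a section of order `0`. -/
theorem IsCuspidal.exists_dvd_sub {n g : ℕ} {E : Fin (n + 1) → PowerSeries ℂ}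
    (h : IsCuspidal g E) (x y z : Fin (n + 1) → ℂ)
    (hy : (∑ i, y i • E i).order = 0) (hz : (∑ i, z i • E i).order = 2) :
    ∃ c : ℕ → ℂ, X ^ (2 * g) ∣ (∑ i, x i • E i) -
      ∑ j ∈ Finset.range g, c j • ((∑ i, y i • E i) *
        ((∑ i, z i • E i) * (∑ i, y i • E i)⁻¹) ^ j) := by
  obtain ⟨⟨O, e, he, hinv, hodd, hmem⟩, -, -⟩ := h
  choose F hF hEF using hmem
  have hcomb : ∀ c : Fin (n + 1) → ℂ, ∑ i, c i • E i = e * ∑ i, c i • F i := by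
    intro c
    rw [Finset.mul_sum]
    exact Finset.sum_congr rfl fun i _ => by rw [mul_smul_comm, ← hEF]
  have hO : ∀ c : Fin (n + 1) → ℂ, ∑ i, c i • F i ∈ O := fun c =>
    Subalgebra.sum_mem _ fun i _ => Subalgebra.smul_mem _ (hF i) _
  rw [hcomb x, hcomb y, hcomb z]
  rw [hcomb, order_mul, order_eq_zero_of_constantCoeff he, zero_add] at hy hz
  set f := ∑ i, x i • F i
  set u := ∑ i, y i • F i
  set s := ∑ i, z i • F i
  have hu : constantCoeff u ≠ 0 := by
    have : u.order = ((0 : ℕ) : ℕ∞) := by simpa using hy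
    simpa using (order_eq_nat.mp this).1
  have hH : (e * s) * (e * u)⁻¹ = s * u⁻¹ := by
    rw [PowerSeries.mul_inv_rev]
    calc e * s * (u⁻¹ * e⁻¹) = (s * u⁻¹) * (e * e⁻¹) := by ring
      _ = _ := by rw [PowerSeries.mul_inv_cancel _ he, mul_one]
  rw [hH]
  set H := s * u⁻¹
  have hHO : H ∈ O := mul_mem (hO z) (hinv u (hO y) hu)
  have hHord : H.order = 2 := by
    rw [order_mul, hz, order_eq_zero_of_constantCoeff (f := u⁻¹), add_zero]
    rw [constantCoeff_inv]; exact inv_ne_zero hu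
  have hpow : ∀ r : ℕ, (H ^ r).order = ((2 * r : ℕ) : ℕ∞) := by
    intro r
    rw [order_pow, hHord, nsmul_eq_mul, mul_comm]
    push_cast; rfl
  have key : ∀ r ≤ g, ∃ c : ℕ → ℂ,
      ∀ l < 2 * r, coeff l (f * u⁻¹ - ∑ j ∈ Finset.range r, c j • H ^ j) = 0 := by
    intro r
    induction r with
    | zero => intro _; exact ⟨0, by simp⟩
    | succ r ih =>
      intro hr
      obtain ⟨c, hc⟩ := ih (by omega)
      set D := f * u⁻¹ - ∑ j ∈ Finset.range r, c j • H ^ j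
      have hlead := (order_eq_nat.mp (hpow r)).1
      let q := coeff (2 * r) D / coeff (2 * r) (H ^ r)
      have hsum : f * u⁻¹ - ∑ j ∈ Finset.range (r + 1), (Function.update c r q) j • H ^ j =
          D - q • H ^ r := by
        rw [Finset.sum_range_succ, Function.update_self, ← sub_sub]
        congr 2
        refine Finset.sum_congr rfl fun j hj => ?_
        rw [Function.update_of_ne (Finset.mem_range.mp hj).ne]
      refine ⟨Function.update c r q, fun l hl => ?_⟩
      rw [hsum]
      have hlow : ∀ l < 2 * r + 1, coeff l (D - q • H ^ r) = 0 := by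
        intro l hl
        rcases Nat.lt_succ_iff_lt_or_eq.mp hl with h | rfl
        · rw [map_sub, hc l h, coeff_smul, (order_eq_nat.mp (hpow r)).2 l h]; simp
        · rw [map_sub, coeff_smul, smul_eq_mul, div_mul_cancel₀ _ hlead, sub_self]
      rcases Nat.lt_or_ge l (2 * r + 1) with h | h
      · exact hlow l h
      · obtain rfl : l = 2 * r + 1 := by omega
        -- The multiple of `H ^ r` was chosen to kill t^(2r). The coefficient at t^(2r+1) vanishes
        -- by itself, since otherwise `O` would contain an element of order 2r+1 < 2g.
        by_contra hne
        refine hodd (D - q • H ^ r) ?_ r (by omega) (order_eq_nat.mpr ⟨hne, hlow⟩)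
        refine sub_mem (sub_mem (mul_mem (hO x) (hinv u (hO y) hu)) ?_)
          (Subalgebra.smul_mem _ (pow_mem hHO r) _)
        exact Subalgebra.sum_mem _ fun j _ => Subalgebra.smul_mem _ (pow_mem hHO j) _
  obtain ⟨c, hc⟩ := key g le_rfl
  refine ⟨c, ?_⟩
  have : e * f - ∑ j ∈ Finset.range g, c j • (e * u * H ^ j) =
      e * u * (f * u⁻¹ - ∑ j ∈ Finset.range g, c j • H ^ j) := by
    have h1 : e * u * ∑ j ∈ Finset.range g, c j • H ^ j =
        ∑ j ∈ Finset.range g, c j • (e * u * H ^ j) := by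
      rw [Finset.mul_sum]
      exact Finset.sum_congr rfl fun j _ => by rw [mul_smul_comm]
    rw [mul_sub, h1]
    congr 1
    calc e * f = e * f * (u * u⁻¹) := by rw [PowerSeries.mul_inv_cancel _ hu, mul_one]
      _ = _ := by ring
  rw [this]
  exact Dvd.dvd.mul_left (X_pow_dvd_iff.mpr hc) _

end

/-! ### Normal forms and their rational parametrization; the target is now ℙ^(n+1). -/

section

open PowerSeries

/-- All coefficients of the power series `F x` are rational functions of the `u t`. -/
def IsRationalSeries {X T : Type} (u : T → X → ℂ) (F : X → PowerSeries ℂ) : Prop :=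
  ∀ l, IsRational u (fun x => coeff l (F x))

namespace IsRationalSeries

variable {X T : Type} {u : T → X → ℂ} {F H : X → PowerSeries ℂ}

theorem one : IsRationalSeries u (fun _ => 1) := fun _ => IsRational.const _

theorem mul (hF : IsRationalSeries u F) (hH : IsRationalSeries u H) :
    IsRationalSeries u (fun x => F x * H x) := by
  intro l
  simp only [coeff_mul]
  exact IsRational.sum fun p _ => (hF p.1).mul (hH p.2)

theorem pow (hF : IsRationalSeries u F) (m : ℕ) : IsRationalSeries u (fun x => F x ^ m) := by
  induction m with
  | zero => simpa using one
  | succ m ih => simpa [pow_succ] using ih.mul hF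

theorem inv (hF : IsRationalSeries u F) (h0 : ∀ x, constantCoeff (F x) ≠ 0) :
    IsRationalSeries u (fun x => (F x)⁻¹) := by
  intro l
  have hc : IsRational u (fun x => (constantCoeff (F x))⁻¹) := by
    refine IsRational.inv ?_ h0
    simpa using hF 0
  induction l using Nat.strong_induction_on with
  | _ l ih =>
    refine IsRational.congr ?_ fun x => PowerSeries.coeff_inv l (F x)
    split_ifs with hl
    · exact hc
    · refine hc.neg.mul (IsRational.sum fun p _ => ?_)
      split_ifs with hp
      · exact (hF _).mul (ih _ hp)
      · exact IsRational.const 0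

end IsRationalSeries

/-- A family of power series in reduced echelon form that is polynomial modulo `t^(2g)` in the
quotient of its first two members, together with a point `θ` and a matrix. The parameters `m₁` and
`m₂` record which of the products `G 0 * (G 1 / G 0) ^ j` have vanishing coefficient
at `t^(2g-1)`. -/
structure NormalForm (n d g m₁ m₂ : ℕ) (k : Fin (n + 2) → ℕ) where
  θ : ℂ
  A : Matrix (Fin (n + 2)) (Fin (n + 2)) ℂ
  G : Fin (n + 2) → PowerSeries ℂ
  pivot : ∀ i l, coeff (k l) (G i) = if l = i then 1 else 0
  low : ∀ i, ∀ l < k i, coeff l (G i) = 0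
  degree : ∀ i l, d < l → coeff l (G i) = 0
  relation : ∀ i, ∃ c : ℕ → ℂ, X ^ (2 * g) ∣ G i -
    ∑ j ∈ Finset.range g, c j • (G 0 * (G 1 * (G 0)⁻¹) ^ j)
  top_eq_zero : ∀ j, m₁ < j → j < g → coeff (2 * g - 1) (G 0 * (G 1 * (G 0)⁻¹) ^ j) = 0
  top_ne_zero : ∀ i : Fin (n + 2), 2 ≤ (i : ℕ) → k i < 2 * m₂ → m₂ < g ∧ d < 2 * g - 1 ∧
    coeff (2 * g - 1) (G 0 * (G 1 * (G 0)⁻¹) ^ m₂) ≠ 0 ∧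
    ∀ j, m₂ < j → j < g → coeff (2 * g - 1) (G 0 * (G 1 * (G 0)⁻¹) ^ j) = 0

/-- The coefficients of a normal form that are determined by the others. -/
def IsDetermined {n : ℕ} (g m₁ m₂ : ℕ) (k : Fin (n + 2) → ℕ) (i : Fin (n + 2)) (l : ℕ) : Prop :=
  (i = 1 ∧ Odd l ∧ l + 2 * m₁ + 1 ≤ 2 * g) ∨ (2 ≤ (i : ℕ) ∧ Odd l ∧ l < 2 * g) ∨
    (2 ≤ (i : ℕ) ∧ l = 2 * m₂ ∧ k i < 2 * m₂)

/-- The index set of the free coefficients of a normal form. -/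
def FreeIndex (n d g m₁ m₂ : ℕ) (k : Fin (n + 2) → ℕ) : Set (Fin (n + 2) × Fin (d + 1)) :=
  {p | k p.1 ≤ p.2 ∧ (∀ i, (p.2 : ℕ) ≠ k i) ∧ ¬ IsDetermined g m₁ m₂ k p.1 p.2}

/-- The index set of the free parameters of a normal form. -/
abbrev Parameter (n d g m₁ m₂ : ℕ) (k : Fin (n + 2) → ℕ) : Type :=
  Unit ⊕ (Fin (n + 2) × Fin (n + 2)) ⊕ FreeIndex n d g m₁ m₂ k

namespace NormalForm

variable {n d g m₁ m₂ : ℕ} {k : Fin (n + 2) → ℕ}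

/-- The free parameters of a normal form. -/
def parameter : Parameter n d g m₁ m₂ k → NormalForm n d g m₁ m₂ k → ℂ
  | .inl _, x => x.θ
  | .inr (.inl p), x => x.A p.1 p.2
  | .inr (.inr p), x => coeff (p.1.2 : ℕ) (x.G p.1.1)

/-- The morphism given by a normal form. -/
def point (b : Bool) (x : NormalForm n d g m₁ m₂ k) : Coeffs (n + 1) d :=
  fun s => ∑ l ∈ Finset.range (d + 1),
    coeff l (∑ m, x.A s.1 m • x.G m) * chartCoeff d b s.2 l x.θ

theorem isRational_θ : IsRational parameter (fun x : NormalForm n d g m₁ m₂ k => x.θ) :=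
  IsRational.coord (u := parameter) (Sum.inl ())

theorem isRational_A (i l : Fin (n + 2)) :
    IsRational parameter (fun x : NormalForm n d g m₁ m₂ k => x.A i l) :=
  IsRational.coord (u := parameter) (Sum.inr (Sum.inl (i, l)))

/-- Such a coefficient is a parameter, or it is 0 or 1 because of the degree, the order or the
echelon form. -/
theorem isRational_of_not_isDetermined {i : Fin (n + 2)} {l : ℕ}
    (h : ¬ IsDetermined g m₁ m₂ k i l) :
    IsRational parameter (fun x : NormalForm n d g m₁ m₂ k => coeff l (x.G i)) := by
  by_cases hd : d < l
  · exact (IsRational.const 0).congr fun x => x.degree i l hd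
  by_cases hl : l < k i
  · exact (IsRational.const 0).congr fun x => x.low i l hl
  by_cases hp : ∃ i', l = k i'
  · obtain ⟨i', rfl⟩ := hp
    exact (IsRational.const _).congr fun x => x.pivot i i'
  · push Not at hd hl hp
    exact IsRational.coord (u := parameter)
      (Sum.inr (Sum.inr ⟨(i, ⟨l, Nat.lt_succ_of_le hd⟩), hl, hp, h⟩))

theorem isRationalSeries_zero :
    IsRationalSeries parameter (fun x : NormalForm n d g m₁ m₂ k => x.G 0) := by
  intro l
  refine isRational_of_not_isDetermined ?_
  simp [IsDetermined]

theorem constantCoeff_zero (h0 : k 0 = 0) (x : NormalForm n d g m₁ m₂ k) :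
    constantCoeff (x.G 0) = 1 := by
  have := x.pivot 0 0
  rw [h0] at this
  simpa using this

theorem exists_eq_X_sq_mul (h1 : k 1 = 2) (x : NormalForm n d g m₁ m₂ k) :
    x.G 1 = X ^ 2 * PowerSeries.mk fun l => coeff (l + 2) (x.G 1) := by
  ext l
  rw [coeff_X_pow_mul']
  split_ifs with hl
  · rw [coeff_mk, Nat.sub_add_cancel hl]
  · exact x.low 1 l (by omega)

theorem section_eq (h1 : k 1 = 2) (x : NormalForm n d g m₁ m₂ k) (j : ℕ) :
    x.G 0 * (x.G 1 * (x.G 0)⁻¹) ^ j = X ^ (2 * j) *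
      (x.G 0 * (x.G 0)⁻¹ ^ j * (PowerSeries.mk fun l => coeff (l + 2) (x.G 1)) ^ j) := by
  conv_lhs => rw [exists_eq_X_sq_mul h1 x]
  rw [pow_mul]; ring

theorem coeff_section_of_lt (h1 : k 1 = 2) (x : NormalForm n d g m₁ m₂ k) {j l : ℕ}
    (hl : l < 2 * j) : coeff l (x.G 0 * (x.G 1 * (x.G 0)⁻¹) ^ j) = 0 := by
  rw [section_eq h1, coeff_X_pow_mul', if_neg (by omega)]

theorem coeff_section_self (h0 : k 0 = 0) (h1 : k 1 = 2) (x : NormalForm n d g m₁ m₂ k) (j : ℕ) :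
    coeff (2 * j) (x.G 0 * (x.G 1 * (x.G 0)⁻¹) ^ j) = 1 := by
  have h2 := x.pivot 1 1
  rw [h1] at h2
  rw [section_eq h1, coeff_X_pow_mul', if_pos le_rfl, Nat.sub_self,
    coeff_zero_eq_constantCoeff_apply]
  simp [constantCoeff_zero h0 x, h2]

/-- The coefficient of `t^r` in `Q * V^j` is linear in the coefficient of `t^r` in `V`. -/
theorem coeff_mul_pow (Q V : PowerSeries ℂ) (r j : ℕ) (hr : 0 < r) (hQ : constantCoeff Q = 1)
    (hV : constantCoeff V = 1) :
    coeff r (Q * V ^ j) =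
      coeff r (Q * (PowerSeries.mk fun s => if s < r then coeff s V else 0) ^ j) + j * coeff r V := by
  set Y : PowerSeries ℂ := PowerSeries.mk fun s => if s < r then coeff s V else 0 with hY
  set Z : PowerSeries ℂ := PowerSeries.mk fun s => coeff (s + r) V with hZ
  have hVYZ : V = Y + X ^ r * Z := by
    ext s
    rw [map_add, coeff_X_pow_mul', hY, hZ, coeff_mk, coeff_mk]
    split_ifs with h1 h2 h2
    · omega
    · simp
    · rw [Nat.sub_add_cancel h2, zero_add]
    · omega
  have hY0 : constantCoeff Y = 1 := by
    rw [← coeff_zero_eq_constantCoeff_apply, hY, coeff_mk, if_pos hr,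
      coeff_zero_eq_constantCoeff_apply, hV]
  have hZ0 : constantCoeff Z = coeff r V := by
    rw [← coeff_zero_eq_constantCoeff_apply, hZ, coeff_mk, zero_add]
  -- With V = Y + X^r Z, where Y is the truncation of V below t^r, the quadratic remainder starts at
  -- t^(2r), beyond t^r since r > 0.
  obtain ⟨K, hK⟩ := Polynomial.powAddExpansion Y (X ^ r * Z) j
  conv_lhs => rw [hVYZ, hK]
  have e : Q * (Y ^ j + (j : PowerSeries ℂ) * Y ^ (j - 1) * (X ^ r * Z) + K * (X ^ r * Z) ^ 2) =
      Q * Y ^ j + X ^ r * (Q * ((j : PowerSeries ℂ) * Y ^ (j - 1)) * Z) +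
        X ^ (2 * r) * (Q * K * Z ^ 2) := by
    rw [mul_comm 2 r, pow_mul]; ring
  rw [e, map_add, map_add, coeff_X_pow_mul', if_pos le_rfl, Nat.sub_self, coeff_X_pow_mul',
    if_neg (by omega), add_zero, coeff_zero_eq_constantCoeff_apply]
  simp [hQ, hY0, hZ0]

/-- By induction on the exponent: a determined coefficient of `G 1` is solved for in the equation
`top_eq_zero`, which contains it linearly, together with lower coefficients of `G 1` and those of `G
0`. -/
theorem isRationalSeries_one (h0 : k 0 = 0) (h1 : k 1 = 2) :
    IsRationalSeries parameter (fun x : NormalForm n d g m₁ m₂ k => x.G 1) := by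
  have hinv : IsRationalSeries parameter (fun x : NormalForm n d g m₁ m₂ k => (x.G 0)⁻¹) :=
    isRationalSeries_zero.inv fun x => by rw [constantCoeff_zero h0]; exact one_ne_zero
  intro l
  induction l using Nat.strong_induction_on with
  | _ l ih =>
    by_cases hdet : IsDetermined g m₁ m₂ k 1 l
    swap
    · exact isRational_of_not_isDetermined hdet
    by_cases hl2 : l < 2
    · exact (IsRational.const 0).congr fun x => x.low 1 l (by omega)
    obtain ⟨hodd, hle⟩ : Odd l ∧ l + 2 * m₁ + 1 ≤ 2 * g := by
      rcases hdet with h | h | h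
      · exact h.2
      · simp at h
      · simp at h
    obtain ⟨q, rfl⟩ := hodd
    -- The coefficient of `G 1` at t^(2q+1) is that of G_1/t^2 at t^(2q-1). It enters the
    -- coefficient of G_0 H^j at t^(2g-1) exactly for j = g - q as the top unknown, with factor j ≠
    -- 0.
    obtain ⟨j, rfl⟩ : ∃ j, g = j + q := ⟨g - q, by omega⟩
    obtain ⟨r, rfl⟩ : ∃ r, q = r + 1 := ⟨q - 1, by omega⟩
    have hj : (j : ℂ) ≠ 0 := Nat.cast_ne_zero.mpr (by omega)
    have hY : IsRationalSeries parameter (fun x : NormalForm n d (j + (r + 1)) m₁ m₂ k =>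
        (PowerSeries.mk fun s => if s < 2 * r + 1 then
          coeff s (PowerSeries.mk fun l => coeff (l + 2) (x.G 1)) else 0 : PowerSeries ℂ)) := by
      intro s
      simp only [coeff_mk]
      split_ifs with hs
      · exact ih (s + 2) (by omega)
      · exact IsRational.const 0
    refine ((((isRationalSeries_zero.mul (hinv.pow j)).mul (hY.pow j)) (2 * r + 1)).neg.mul
      (IsRational.const (j : ℂ)⁻¹)).congr fun x => ?_
    have htop := x.top_eq_zero j (by omega) (by omega)
    have hlead := x.pivot 1 1
    rw [h1] at hlead
    rw [section_eq h1, coeff_X_pow_mul', if_pos (by omega),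
      show 2 * (j + (r + 1)) - 1 - 2 * j = 2 * r + 1 by omega,
      coeff_mul_pow _ _ _ _ (by omega) (by simp [constantCoeff_zero h0 x])
        (by simp [hlead]), coeff_mk, show 2 * r + 1 + 2 = 2 * (r + 1) + 1 by ring] at htop
    rw [neg_eq_of_add_eq_zero_right htop, mul_comm (j : ℂ), mul_assoc, mul_inv_cancel₀ hj,
      mul_one]

theorem isRationalSeries_section (h0 : k 0 = 0) (h1 : k 1 = 2) (j : ℕ) :
    IsRationalSeries parameter
      (fun x : NormalForm n d g m₁ m₂ k => x.G 0 * (x.G 1 * (x.G 0)⁻¹) ^ j) :=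
  isRationalSeries_zero.mul (((isRationalSeries_one h0 h1).mul
    (isRationalSeries_zero.inv fun x => by rw [constantCoeff_zero h0]; exact one_ne_zero)).pow j)

/-- The coefficients c_j of the relation modulo t^(2g) are found recursively from the parameters;
they give all coefficients of `G i` below t^(2g). -/
theorem isRationalSeries_of_two_le (h0 : k 0 = 0) (h1 : k 1 = 2) (i : Fin (n + 2))
    (hi : 2 ≤ (i : ℕ)) :
    IsRationalSeries parameter (fun x : NormalForm n d g m₁ m₂ k => x.G i) := by
  choose c hc using fun x : NormalForm n d g m₁ m₂ k => x.relation i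
  have hcoeff : ∀ l < 2 * g, ∀ x : NormalForm n d g m₁ m₂ k, coeff l (x.G i) =
      ∑ j ∈ Finset.range g, c x j * coeff l (x.G 0 * (x.G 1 * (x.G 0)⁻¹) ^ j) := by
    intro l hl x
    have := X_pow_dvd_iff.mp (hc x) l hl
    rw [map_sub, sub_eq_zero, map_sum] at this
    simpa only [coeff_smul, smul_eq_mul] using this
  have hsplit : ∀ (w : ℕ → ℂ) (m : ℕ), m < g → (∀ j, m < j → j < g → w j = 0) →
      ∀ x : NormalForm n d g m₁ m₂ k, ∑ j ∈ Finset.range g, c x j * w j =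
        ∑ j ∈ Finset.range m, c x j * w j + c x m * w m := by
    intro w m hm hw x
    rw [← Finset.sum_range_succ]
    refine (Finset.sum_subset (Finset.range_mono hm) fun j hj hj' => ?_).symm
    rw [hw j (by simpa using hj') (by simpa using hj), mul_zero]
  have hrat : ∀ j < g, IsRational parameter (fun x => c x j) := by
    intro j
    induction j using Nat.strong_induction_on with
    | _ j ih =>
      intro hj
      -- In general c_j is read off at t^(2j), where G_0 H^j has coefficient 1 and later products
      -- vanish. In the exceptional case t^(2j) carries no parameter, and c_j is read off at
      -- t^(2g-1): there `G i` vanishes by degree, G_0 H^j does not vanish, and later products do.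
      by_cases hm : j = m₂ ∧ k i < 2 * m₂
      · obtain ⟨rfl, hk⟩ := hm
        refine ((IsRational.sum (s := Finset.range j) fun j' hj' =>
          (ih j' (Finset.mem_range.mp hj') ((Finset.mem_range.mp hj').trans hj)).mul
            (isRationalSeries_section h0 h1 j' (2 * g - 1))).neg.mul
          ((isRationalSeries_section h0 h1 j (2 * g - 1)).inv fun x =>
            (x.top_ne_zero i hi hk).2.2.1)).congr fun x => ?_
        obtain ⟨-, hd, hne, hz⟩ := x.top_ne_zero i hi hk
        have h2 := hcoeff (2 * g - 1) (by omega) x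
        rw [x.degree i _ hd, hsplit _ j hj hz] at h2
        rw [neg_eq_of_add_eq_zero_right h2.symm, mul_assoc, mul_inv_cancel₀ hne, mul_one]
      · have hfree : ¬ IsDetermined g m₁ m₂ k i (2 * j) := by
          rintro (h | h | h)
          · exact (Nat.not_odd_iff_even.mpr (even_two_mul j)) h.2.1
          · exact (Nat.not_odd_iff_even.mpr (even_two_mul j)) h.2.1
          · exact hm ⟨by omega, h.2.2⟩
        refine ((isRational_of_not_isDetermined hfree).sub
          (IsRational.sum (s := Finset.range j) fun j' hj' =>
          (ih j' (Finset.mem_range.mp hj') ((Finset.mem_range.mp hj').trans hj)).mul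
            (isRationalSeries_section h0 h1 j' (2 * j)))).congr fun x => ?_
        rw [hcoeff (2 * j) (by omega) x, hsplit _ j hj fun j' h _ =>
          coeff_section_of_lt h1 x (by omega), coeff_section_self h0 h1]
        ring
  intro l
  rcases Nat.lt_or_ge l (2 * g) with hl | hl
  · exact (IsRational.sum (s := Finset.range g) fun j hj =>
      (hrat j (Finset.mem_range.mp hj)).mul (isRationalSeries_section h0 h1 j l)).congr
        fun x => hcoeff l hl x
  · by_cases hdet : IsDetermined g m₁ m₂ k i l
    swap
    · exact isRational_of_not_isDetermined hdet
    rcases isEmpty_or_nonempty (NormalForm n d g m₁ m₂ k) with hX | ⟨⟨x⟩⟩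
    · exact (IsRational.const 0).congr fun x => (hX.false x).elim
    exfalso
    rcases hdet with h | h | h
    · omega
    · omega
    · have := (x.top_ne_zero i hi h.2.2).1
      omega

theorem isRationalSeries_G (h0 : k 0 = 0) (h1 : k 1 = 2) (i : Fin (n + 2)) :
    IsRationalSeries parameter (fun x : NormalForm n d g m₁ m₂ k => x.G i) := by
  by_cases hi : 2 ≤ (i : ℕ)
  · exact isRationalSeries_of_two_le h0 h1 i hi
  · have : i = 0 ∨ i = 1 := by
      rcases i with ⟨i, h⟩
      simp only [Fin.ext_iff, Fin.val_zero, Fin.val_one] at *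
      omega
    rcases this with rfl | rfl
    · exact isRationalSeries_zero
    · exact isRationalSeries_one h0 h1

theorem isRational_point (h0 : k 0 = 0) (h1 : k 1 = 2) (b : Bool)
    (s : Fin (n + 2) × Fin (d + 1)) :
    IsRational parameter (fun x : NormalForm n d g m₁ m₂ k => x.point b s) := by
  refine IsRational.sum fun l _ => IsRational.mul ?_ ?_
  · simp only [map_sum, coeff_smul, smul_eq_mul]
    exact IsRational.sum fun m _ => (isRational_A _ _).mul (isRationalSeries_G h0 h1 m l)
  · unfold chartCoeff
    split_ifs
    · exact IsRational.const _
    · exact IsRational.const _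
    · exact (isRational_θ.neg.pow _).mul (IsRational.const _)

theorem zariskiDim_range_point_le (h0 : k 0 = 0) (h1 : k 1 = 2) (b : Bool) :
    zariskiDim (Set.range (point b : NormalForm n d g m₁ m₂ k → _)) ≤
      (1 + ((n + 2) ^ 2 + (FreeIndex n d g m₁ m₂ k).ncard) : ℕ) := by
  classical
  have := Fintype.ofFinite (FreeIndex n d g m₁ m₂ k)
  refine (zariskiDim_range_le parameter _ (isRational_point h0 h1 b)).trans (le_of_eq ?_)
  rw [Fintype.card_sum, Fintype.card_sum, Fintype.card_unit, Fintype.card_prod, Fintype.card_fin,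
    Set.ncard_eq_toFinset_card', Set.toFinset_card, sq]

end NormalForm

end

/-! ### Every cuspidal expansion comes from an admissible normal form. -/

section

open PowerSeries

/-- The morphisms whose expansion at some point is cuspidal with vanishing orders `k`. -/
def cuspidalSet (n d g : ℕ) (k : Fin (n + 2) → ℕ) : Set (Coeffs (n + 1) d) :=
  {a | LinearIndependent ℂ (fun (i : Fin (n + 2)) (j : Fin (d + 1)) => a (i, j)) ∧
    ∃ (b : Bool) (θ : ℂ) (E : Fin (n + 2) → PowerSeries ℂ), IsCuspidal g E ∧
      orderSet E = Set.range k ∧ (∀ i l, d < l → coeff l (E i) = 0) ∧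
      ∀ i j, a (i, j) = ∑ l ∈ Finset.range (d + 1), coeff l (E i) * chartCoeff d b j l θ}

/-- The position of `x` among the elements of the semigroup `⟨2, 2g + 1⟩`. -/
def position (g x : ℕ) : ℕ := if x ≤ 2 * g then x / 2 else x - g

/-- The properties of a sequence of vanishing orders at a hyperelliptic cusp. -/
structure IsOrderSequence {n : ℕ} (d g : ℕ) (k : Fin (n + 2) → ℕ) : Prop where
  strictMono : StrictMono k
  zero : k 0 = 0
  one : k 1 = 2
  even_or_le : ∀ i, Even (k i) ∨ 2 * g + 1 ≤ k i
  le : ∀ i, k i ≤ d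

/-- The values of the parameters `m₁`, `m₂` of the normal forms that are needed. -/
def IsAdmissible {n : ℕ} (d g : ℕ) (k : Fin (n + 2) → ℕ) (m₁ m₂ : ℕ) : Prop :=
  (2 * g ≤ d + 1 ∧ m₁ = g ∧ m₂ = 0) ∨
    (d + 2 = 2 * g ∧ 1 ≤ m₁ ∧ m₁ < g ∧ m₂ = m₁ ∧ ∀ i : Fin (n + 2), 2 ≤ (i : ℕ) → k i ≠ 2 * m₁)

/-- The coefficients of the forms depend linearly on `E`, so a relation in `E` is a relation between
the forms. -/
theorem linearIndependent_expansion {n d : ℕ} {a : Coeffs n d}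
    (ha : LinearIndependent ℂ (fun (i : Fin (n + 1)) (j : Fin (d + 1)) => a (i, j)))
    {M : Fin (d + 1) → ℕ → ℂ} {E : Fin (n + 1) → PowerSeries ℂ}
    (h : ∀ i j, a (i, j) = ∑ l ∈ Finset.range (d + 1), coeff l (E i) * M j l) :
    LinearIndependent ℂ E := by
  rw [Fintype.linearIndependent_iff] at ha ⊢
  intro c hc
  refine ha c (funext fun j => ?_)
  simp only [Finset.sum_apply, Pi.smul_apply, smul_eq_mul, Pi.zero_apply, h]
  simp_rw [Finset.mul_sum]
  rw [Finset.sum_comm]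
  refine Finset.sum_eq_zero fun l _ => ?_
  have : coeff l (∑ i, c i • E i) = 0 := by rw [hc]; simp
  simp only [map_sum, coeff_smul, smul_eq_mul] at this
  simp_rw [← mul_assoc, ← Finset.sum_mul, this, zero_mul]

theorem IsCuspidal.even_or_le {n g : ℕ} {E : Fin (n + 1) → PowerSeries ℂ} (h : IsCuspidal g E)
    {m : ℕ} (hm : m ∈ orderSet E) : Even m ∨ 2 * g + 1 ≤ m := by
  obtain ⟨⟨O, e, he, -, hodd, hmem⟩, -, -⟩ := h
  choose F hF hEF using hmem
  obtain ⟨c, hc⟩ := hm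
  have hcomb : ∑ i, c i • E i = e * ∑ i, c i • F i := by
    rw [Finset.mul_sum]
    exact Finset.sum_congr rfl fun i _ => by rw [mul_smul_comm, ← hEF]
  rw [hcomb, order_mul, order_eq_zero_of_constantCoeff he, zero_add] at hc
  rcases Nat.even_or_odd' m with ⟨r, rfl | rfl⟩
  · exact Or.inl (even_two_mul r)
  · by_contra! hlt
    exact hodd _ (Subalgebra.sum_mem _ fun i _ => Subalgebra.smul_mem _ (hF i) _) r (by omega) hc

theorem IsCuspidal.isOrderSequence {n d g : ℕ} (hg : 0 < g) {E : Fin (n + 2) → PowerSeries ℂ}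
    (h : IsCuspidal g E) {k : Fin (n + 2) → ℕ} (hk : StrictMono k)
    (hkE : orderSet E = Set.range k) (hd : ∀ i l, d < l → coeff l (E i) = 0) :
    IsOrderSequence d g k := by
  have hmem : ∀ i, k i ∈ orderSet E := fun i => by rw [hkE]; exact ⟨i, rfl⟩
  have hpar : ∀ i, Even (k i) ∨ 2 * g + 1 ≤ k i := fun i => h.even_or_le (hmem i)
  obtain ⟨i0, hi0⟩ : 0 ∈ Set.range k := hkE ▸ h.2.1
  obtain ⟨i2, hi2⟩ : 2 ∈ Set.range k := hkE ▸ h.2.2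
  have h0 : k 0 = 0 := Nat.le_zero.mp (hi0 ▸ hk.monotone (Fin.zero_le i0))
  have h1 : k 1 = 2 := by
    have hlt : k 0 < k 1 := hk (by simp)
    have hne : k 1 ≠ 1 := by
      intro h1
      rcases hpar 1 with h | h
      · rw [h1] at h; exact absurd h (by decide)
      · omega
    have hle : k 1 ≤ k i2 := by
      refine hk.monotone ?_
      have : i2 ≠ 0 := fun h => by rw [h] at hi2; omega
      exact Fin.one_le_of_ne_zero this
    omega
  refine ⟨hk, h0, h1, hpar, fun i => ?_⟩
  obtain ⟨c, hc⟩ := hmem i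
  by_contra hm
  refine (order_eq_nat.mp hc).1 ?_
  rw [map_sum]
  exact Finset.sum_eq_zero fun l _ => by rw [coeff_smul, hd l _ (by omega), smul_zero]

theorem mem_range_point {n d g : ℕ} (hnd : n + 1 ≤ d) (hd : 2 * g ≤ d + 2)
    {k : Fin (n + 2) → ℕ} (hseq : IsOrderSequence d g k) {a : Coeffs (n + 1) d}
    (ha : a ∈ cuspidalSet n d g k) :
    ∃ (b : Bool) (m₁ m₂ : ℕ), IsAdmissible d g k m₁ m₂ ∧
      a ∈ Set.range (NormalForm.point b : NormalForm n d g m₁ m₂ k → _) := by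
  obtain ⟨hlin, b, θ, E, hcusp, hkE, hdeg, hpt⟩ := ha
  obtain ⟨A, B, G, hEG, hGE, hpivot, hlow⟩ :=
    exists_echelon (linearIndependent_expansion hlin hpt) hkE
  have hGdeg : ∀ i l, d < l → coeff l (G i) = 0 := by
    intro i l hl
    rw [hGE, map_sum]
    exact Finset.sum_eq_zero fun m _ => by rw [coeff_smul, hdeg m l hl, smul_zero]
  have hord : ∀ i, (G i).order = (k i : ℕ∞) := fun i =>
    order_eq_nat.mpr ⟨by rw [hpivot]; simp, hlow i⟩
  have hrel : ∀ i, ∃ c : ℕ → ℂ, X ^ (2 * g) ∣ G i -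
      ∑ j ∈ Finset.range g, c j • (G 0 * (G 1 * (G 0)⁻¹) ^ j) := by
    intro i
    have := hcusp.exists_dvd_sub (B i) (B 0) (B 1)
      (by rw [← hGE, hord, hseq.zero]; rfl) (by rw [← hGE, hord, hseq.one]; rfl)
    simpa only [← hGE] using this
  have hG0 : constantCoeff (G 0) ≠ 0 := by
    have := (order_eq_nat.mp (hord 0)).1
    rw [hseq.zero] at this
    simpa using this
  have finish : ∀ m₁ m₂ : ℕ, IsAdmissible d g k m₁ m₂ →
      (∀ j, m₁ < j → j < g → coeff (2 * g - 1) (G 0 * (G 1 * (G 0)⁻¹) ^ j) = 0) →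
      (∀ i : Fin (n + 2), 2 ≤ (i : ℕ) → k i < 2 * m₂ → m₂ < g ∧ d < 2 * g - 1 ∧
        coeff (2 * g - 1) (G 0 * (G 1 * (G 0)⁻¹) ^ m₂) ≠ 0 ∧
        ∀ j, m₂ < j → j < g → coeff (2 * g - 1) (G 0 * (G 1 * (G 0)⁻¹) ^ j) = 0) →
      ∃ (b : Bool) (m₁ m₂ : ℕ), IsAdmissible d g k m₁ m₂ ∧
        a ∈ Set.range (NormalForm.point b : NormalForm n d g m₁ m₂ k → _) := by
    intro m₁ m₂ hadm htz htn
    refine ⟨b, m₁, m₂, hadm, ⟨θ, A, G, hpivot, hlow, hGdeg, hrel, htz, htn⟩, ?_⟩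
    funext s
    simp only [NormalForm.point, ← hEG]
    exact (hpt s.1 s.2).symm
  rcases Nat.lt_or_ge (d + 1) (2 * g) with hlt | hge
  swap
  -- If 2g-1 ≤ d, all odd exponents below 2g are available; the choice m₁ = g, m₂ = 0 makes both top
  -- conditions vacuous.
  · exact finish g 0 (Or.inl ⟨hge, rfl, rfl⟩) (fun j h h' => by omega) fun i _ h => by omega
  have hd2 : d + 2 = 2 * g := by omega
  by_cases hex : ∃ j, j < g ∧ coeff (2 * g - 1) (G 0 * (G 1 * (G 0)⁻¹) ^ j) ≠ 0
  · classical
    obtain ⟨j₀, hj₀, hj₀'⟩ := hex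
    let P : ℕ → Prop := fun j => j < g ∧ coeff (2 * g - 1) (G 0 * (G 1 * (G 0)⁻¹) ^ j) ≠ 0
    set m := Nat.findGreatest P g with hm
    have hPm : P m := Nat.findGreatest_spec (P := P) hj₀.le ⟨hj₀, hj₀'⟩
    have hmax : ∀ j, m < j → j < g → coeff (2 * g - 1) (G 0 * (G 1 * (G 0)⁻¹) ^ j) = 0 := by
      intro j hj hjg
      by_contra hne
      exact Nat.findGreatest_is_greatest hj hjg.le ⟨hjg, hne⟩
    -- For j = 0 the product is `G 0`, whose degree is at most d < 2g-1.
    have hm1 : 1 ≤ m := by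
      by_contra h
      have h0 : m = 0 := by omega
      refine hPm.2 ?_
      rw [h0, pow_zero, mul_one]
      exact hGdeg 0 _ (by omega)
    refine finish m m (Or.inr ⟨hd2, hm1, hPm.1, rfl, fun i _ hki => ?_⟩) hmax
      fun i _ _ => ⟨hPm.1, by omega, hPm.2, hmax⟩
    obtain ⟨c, hc⟩ := hrel i
    rw [X_pow_dvd_iff] at hc
    have hS : (G 1 * (G 0)⁻¹).order = 2 := by
      rw [order_mul, hord, hseq.one, order_eq_zero_of_constantCoeff (f := (G 0)⁻¹)]
      · rfl
      · rw [constantCoeff_inv]; exact inv_ne_zero hG0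
    have hsec : ∀ j : ℕ, (G 0 * (G 1 * (G 0)⁻¹) ^ j).order = ((2 * j : ℕ) : ℕ∞) := by
      intro j
      rw [order_mul, order_pow, hS, order_eq_zero_of_constantCoeff hG0, zero_add, nsmul_eq_mul,
        mul_comm]
      push_cast; rfl
    have hcoeff : ∀ l < 2 * g, coeff l (G i) =
        ∑ j ∈ Finset.range g, c j * coeff l (G 0 * (G 1 * (G 0)⁻¹) ^ j) := by
      intro l hl
      have := hc l hl
      rw [map_sub, sub_eq_zero, map_sum] at this
      simpa only [coeff_smul, smul_eq_mul] using this
    have hsplit : ∀ l < 2 * g, ∀ m < g, (∀ j < m, c j = 0) →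
        (∀ j, m < j → j < g → coeff l (G 0 * (G 1 * (G 0)⁻¹) ^ j) = 0) →
        coeff l (G i) = c m * coeff l (G 0 * (G 1 * (G 0)⁻¹) ^ m) := by
      intro l hl m hm h1 h2
      rw [hcoeff l hl, Finset.sum_eq_single m]
      · intro j hj hjm
        rcases lt_or_gt_of_ne hjm with h | h
        · rw [h1 j h, zero_mul]
        · rw [h2 j h (Finset.mem_range.mp hj), mul_zero]
      · intro h; exact absurd (Finset.mem_range.mpr hm) h
    -- If `G i` had order 2m, the c_j with j < m would vanish successively. Its coefficient at
    -- t^(2g-1), zero by degree, would be c_m times a nonzero number, so c_m = 0, against the pivot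
    -- 1 at t^(2m).
    have hc0 : ∀ j < m, c j = 0 := by
      intro j
      induction j using Nat.strong_induction_on with
      | _ j ih =>
        intro hj
        have hjg : j < g := hj.trans hPm.1
        have h1 := hsplit (2 * j) (by omega) j hjg (fun j' h => ih j' h (h.trans hj))
          fun j' h _ => (order_eq_nat.mp (hsec j')).2 _ (by omega)
        rw [hlow i (2 * j) (by omega)] at h1
        exact (mul_eq_zero.mp h1.symm).resolve_right (order_eq_nat.mp (hsec j)).1
    have htop := hsplit (2 * g - 1) (by omega) m hPm.1 hc0 hmax
    rw [hGdeg i _ (by omega)] at htop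
    have hcm := (mul_eq_zero.mp htop.symm).resolve_right hPm.2
    have hlead := hsplit (2 * m) (by have := hPm.1; omega) m hPm.1 hc0
      fun j' h _ => (order_eq_nat.mp (hsec j')).2 _ (by omega)
    rw [hcm, zero_mul, ← hki, hpivot] at hlead
    simp at hlead
  · push Not at hex
    -- Here all top coefficients vanish. The value 1 is admissible because k_i > 2 for i ≥ 2, so the
    -- premise of `top_ne_zero` never holds.
    refine finish 1 1 (Or.inr ⟨hd2, le_rfl, by omega, rfl, fun i hi hki => ?_⟩)
      (fun j _ h => hex j h) fun i hi hki => ?_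
    · have : i = 1 := hseq.strictMono.injective (hki.trans hseq.one.symm)
      rw [this] at hi; simp at hi
    · have : k 1 ≤ k i := hseq.strictMono.monotone 
        (Fin.le_def.mpr (by rw [Fin.val_one]; omega))
      rw [hseq.one] at this
      omega

end

/-! ### Counting the free parameters. -/

section

open Classical in
/-- The free coefficients of the `i`-th member of a normal form. -/
def freeRow {n : ℕ} (d g m₁ m₂ : ℕ) (k : Fin (n + 2) → ℕ) (i : Fin (n + 2)) : Finset ℕ :=
  (Finset.range (d + 1)).filter fun l =>
    k i ≤ l ∧ (∀ i', l ≠ k i') ∧ ¬ IsDetermined g m₁ m₂ k i l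

theorem ncard_freeIndex_le {n : ℕ} (d g m₁ m₂ : ℕ) (k : Fin (n + 2) → ℕ) :
    (FreeIndex n d g m₁ m₂ k).ncard ≤ ∑ i, (freeRow d g m₁ m₂ k i).card := by
  classical
  rw [← Finset.card_sigma, ← Set.ncard_coe_finset]
  refine Set.ncard_le_ncard_of_injOn (fun p => ⟨p.1, (p.2 : ℕ)⟩) ?_ ?_ (Finset.finite_toSet _)
  · rintro ⟨i, l⟩ hp
    simp only [Finset.coe_sigma, Set.mem_sigma_iff, Finset.mem_coe, Finset.mem_univ, true_and,
      freeRow, Finset.mem_filter, Finset.mem_range]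
    exact ⟨l.2, hp⟩
  · rintro ⟨i, l⟩ - ⟨i', l'⟩ - h
    simp only [Sigma.mk.injEq, heq_eq_eq] at h
    exact Prod.ext h.1 (Fin.ext h.2)

/-- Among the d+1 exponents, those below k_i, the pivots k_i' with i' ≥ i, and the determined
exponents in `D` are disjoint from each other and from the free ones. -/
theorem card_freeRow_add_le {n d g m₁ m₂ : ℕ} {k : Fin (n + 2) → ℕ}
    (hseq : IsOrderSequence d g k) (i : Fin (n + 2)) (D : Finset ℕ)
    (hD : ∀ l ∈ D, k i ≤ l ∧ l ≤ d ∧ (∀ i', l ≠ k i') ∧ IsDetermined g m₁ m₂ k i l) :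
    (freeRow d g m₁ m₂ k i).card + (k i + (n + 2 - i) + D.card) ≤ d + 1 := by
  classical
  let P : Finset ℕ := (Finset.Ici i).map ⟨k, hseq.strictMono.injective⟩
  have hP : P.card = n + 2 - i := by simp [P]
  have hPmem : ∀ l ∈ P, k i ≤ l ∧ ∃ i', l = k i' := by
    intro l hl
    obtain ⟨i', hi', rfl⟩ := Finset.mem_map.mp hl
    exact ⟨hseq.strictMono.monotone (Finset.mem_Ici.mp hi'), i', rfl⟩
  have hF : ∀ l ∈ freeRow d g m₁ m₂ k i, l < d + 1 ∧ k i ≤ l ∧ (∀ i', l ≠ k i') ∧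
      ¬ IsDetermined g m₁ m₂ k i l := by
    intro l hl
    simpa [freeRow] using hl
  have h1 : Disjoint (Finset.range (k i)) P := by
    rw [Finset.disjoint_left]
    intro l hl hl'
    have := (hPmem l hl').1
    rw [Finset.mem_range] at hl
    omega
  have h2 : Disjoint (Finset.range (k i) ∪ P) D := by
    rw [Finset.disjoint_right]
    intro l hl hl'
    obtain ⟨ha, hb, hc, -⟩ := hD l hl
    rcases Finset.mem_union.mp hl' with h | h
    · rw [Finset.mem_range] at h; omega
    · obtain ⟨-, i', rfl⟩ := hPmem l h
      exact hc i' rfl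
  have h3 : Disjoint (freeRow d g m₁ m₂ k i) (Finset.range (k i) ∪ P ∪ D) := by
    rw [Finset.disjoint_left]
    intro l hl hl'
    obtain ⟨ha, hb, hc, hd⟩ := hF l hl
    rcases Finset.mem_union.mp hl' with h | h
    · rcases Finset.mem_union.mp h with h | h
      · rw [Finset.mem_range] at h; omega
      · obtain ⟨-, i', rfl⟩ := hPmem l h
        exact hc i' rfl
    · exact hd (hD l h).2.2.2
  have hsub : freeRow d g m₁ m₂ k i ∪ (Finset.range (k i) ∪ P ∪ D) ⊆ Finset.range (d + 1) := by
    intro l hl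
    rw [Finset.mem_range]
    have hki := hseq.le i
    rcases Finset.mem_union.mp hl with h | h
    · exact (hF l h).1
    rcases Finset.mem_union.mp h with h | h
    · rcases Finset.mem_union.mp h with h | h
      · rw [Finset.mem_range] at h; omega
      · obtain ⟨-, i', rfl⟩ := hPmem l h
        exact Nat.lt_succ_of_le (hseq.le i')
    · exact Nat.lt_succ_of_le (hD l h).2.1
  have := Finset.card_le_card hsub
  rw [Finset.card_union_of_disjoint h3, Finset.card_union_of_disjoint h2,
    Finset.card_union_of_disjoint h1, Finset.card_range, Finset.card_range, hP] at this
  exact this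

/-- The odd numbers `2 q + 1` with `a ≤ q < b`. -/
def oddsBetween (a b : ℕ) : Finset ℕ :=
  (Finset.Ico a b).map ⟨fun q => 2 * q + 1, fun q q' h => by simpa using h⟩

theorem card_oddsBetween (a b : ℕ) : (oddsBetween a b).card = b - a := by simp [oddsBetween]

theorem mem_oddsBetween {a b l : ℕ} : l ∈ oddsBetween a b ↔ ∃ q, a ≤ q ∧ q < b ∧ l = 2 * q + 1 := by
  simp only [oddsBetween, Finset.mem_map, Finset.mem_Ico, and_assoc, eq_comm]
  exact Iff.rfl

theorem IsOrderSequence.ne_odd {n d g : ℕ} {k : Fin (n + 2) → ℕ} (hseq : IsOrderSequence d g k)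
    {q : ℕ} (hq : q < g) (i : Fin (n + 2)) : 2 * q + 1 ≠ k i := by
  intro h
  rcases hseq.even_or_le i with h' | h'
  · rw [← h] at h'
    exact (Nat.not_even_iff_odd.mpr ⟨q, rfl⟩) h'
  · omega

theorem card_freeRow_one {n d g m₁ m₂ : ℕ} {k : Fin (n + 2) → ℕ} (hseq : IsOrderSequence d g k)
    (hd : 2 * g ≤ d + 2) (hm : 1 ≤ m₁) :
    (freeRow d g m₁ m₂ k 1).card + (n + 3 + (g - m₁ - 1)) ≤ d + 1 := by
  have := card_freeRow_add_le (m₁ := m₁) (m₂ := m₂) hseq 1 (oddsBetween 1 (g - m₁)) (by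
    intro l hl
    obtain ⟨q, h1, h2, rfl⟩ := mem_oddsBetween.mp hl
    refine ⟨by rw [hseq.one]; omega, by omega, hseq.ne_odd (by omega), Or.inl ⟨rfl, ⟨q, rfl⟩, ?_⟩⟩
    omega)
  rw [card_oddsBetween, hseq.one] at this
  simp only [Fin.val_one] at this
  omega

theorem card_freeRow_of_large {n d g m₁ m₂ : ℕ} {k : Fin (n + 2) → ℕ}
    (hseq : IsOrderSequence d g k) (hd : 2 * g ≤ d + 1) (i : Fin (n + 2)) (hi : 2 ≤ (i : ℕ)) :
    (freeRow d g m₁ m₂ k i).card + ((n + 2 - i) + g + position g (k i)) ≤ d + 1 := by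
  have := card_freeRow_add_le (m₁ := m₁) (m₂ := m₂) hseq i (oddsBetween (k i / 2) g) (by
    intro l hl
    obtain ⟨q, h1, h2, rfl⟩ := mem_oddsBetween.mp hl
    exact ⟨by omega, by omega, hseq.ne_odd h2, Or.inr (Or.inl ⟨hi, ⟨q, rfl⟩, by omega⟩)⟩)
  rw [card_oddsBetween] at this
  have hp := hseq.even_or_le i
  rw [Nat.even_iff] at hp
  unfold position
  split_ifs <;> omega

/-- Compared with `card_freeRow_of_large` the odd exponent 2g-1 is missing. For k_i < 2m the
determined exponent 2m replaces it; otherwise one extra free coefficient remains. -/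
theorem card_freeRow_of_small {n d g m : ℕ} {k : Fin (n + 2) → ℕ}
    (hseq : IsOrderSequence d g k) (hd : d + 2 = 2 * g) (hm : m < g)
    (hk : ∀ i : Fin (n + 2), 2 ≤ (i : ℕ) → k i ≠ 2 * m) (i : Fin (n + 2)) (hi : 2 ≤ (i : ℕ)) :
    (freeRow d g m m k i).card + ((n + 2 - i) + g + position g (k i)) ≤
      d + 1 + if 2 * m < k i then 1 else 0 := by
  have hle := hseq.le i
  have hp := hseq.even_or_le i
  rw [Nat.even_iff] at hp
  have hne := hk i hi
  have hpos : position g (k i) = k i / 2 := by rw [position, if_pos (by omega)]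
  rw [hpos]
  have hodd : ∀ l ∈ oddsBetween (k i / 2) (g - 1), k i ≤ l ∧ l ≤ d ∧ (∀ i', l ≠ k i') ∧
      IsDetermined g m m k i l := by
    intro l hl
    obtain ⟨q, h1, h2, rfl⟩ := mem_oddsBetween.mp hl
    exact ⟨by omega, by omega, hseq.ne_odd (by omega),
      Or.inr (Or.inl ⟨hi, ⟨q, rfl⟩, by omega⟩)⟩
  split_ifs with h
  · have := card_freeRow_add_le hseq i _ hodd
    rw [card_oddsBetween] at this
    omega
  · have hlt : k i < 2 * m := by omega
    have hnot : 2 * m ∉ oddsBetween (k i / 2) (g - 1) := by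
      rw [mem_oddsBetween]
      rintro ⟨q, -, -, h⟩
      omega
    have := card_freeRow_add_le (m₁ := m) (m₂ := m) hseq i
      (insert (2 * m) (oddsBetween (k i / 2) (g - 1))) (by
        intro l hl
        rcases Finset.mem_insert.mp hl with rfl | hl
        · refine ⟨hlt.le, by omega, fun i' h' => ?_, Or.inr (Or.inr ⟨hi, rfl, hlt⟩)⟩
          by_cases hi' : 2 ≤ (i' : ℕ)
          · exact hk i' hi' h'.symm
          · have : k i' ≤ k i := hseq.strictMono.monotone (Fin.le_def.mpr (by omega))
            omega
        · exact hodd l hl)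
    rw [Finset.card_insert_of_notMem hnot, card_oddsBetween] at this
    omega

/-- A lower bound for the codimension of the stratum with vanishing orders `k`. -/
def codimBound {n : ℕ} (g : ℕ) (k : Fin (n + 2) → ℕ) : ℤ :=
  n * g + ∑ i : Fin n, ((position g (k i.succ.succ) : ℤ) - ((i : ℕ) + 2))

/-- With the row bounds summed, the (n+2)² entries of the matrix and θ cancel against the pivots,
the order 2 of row 1 and the terms i + 2 in `codimBound`. -/
theorem card_parameters_le {n d g m₁ m₂ : ℕ} {k : Fin (n + 2) → ℕ}
    (hseq : IsOrderSequence d g k) (hd : 2 * g ≤ d + 2) (hg : 0 < g)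
    (hadm : IsAdmissible d g k m₁ m₂) :
    ((1 + ((n + 2) ^ 2 + (FreeIndex n d g m₁ m₂ k).ncard) : ℕ) : ℤ) + codimBound g k ≤
      (n + 2) * (d + 1) := by
  have hsum := ncard_freeIndex_le d g m₁ m₂ k
  rw [Fin.sum_univ_succ, Fin.sum_univ_succ] at hsum
  have h0 := card_freeRow_add_le (m₁ := m₁) (m₂ := m₂) hseq 0 ∅ (by simp)
  rw [hseq.zero] at h0
  simp only [Fin.val_zero, Finset.card_empty] at h0
  have h1 := card_freeRow_one (m₁ := m₁) (m₂ := m₂) hseq hd (by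
    rcases hadm with h | h <;> omega)
  rw [show Fin.succ (0 : Fin (n + 1)) = 1 from rfl] at hsum
  -- `z i` is the excess of a row over the generic count. The total excess is at most the number g -
  -- m₁ - 1 of determined coefficients of row 1.
  have hrow : ∃ z : Fin n → ℕ, ∑ i, z i ≤ g - m₁ - 1 ∧ ∀ i : Fin n,
      (freeRow d g m₁ m₂ k i.succ.succ).card + ((n - i) + g + position g (k i.succ.succ)) ≤
        d + 1 + z i := by
    have hval : ∀ i : Fin n, n + 2 - (i.succ.succ : Fin (n + 2)).val = n - i := by
      intro i; simp only [Fin.val_succ]; omega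
    have htwo : ∀ i : Fin n, 2 ≤ (i.succ.succ : Fin (n + 2)).val := by
      intro i; simp only [Fin.val_succ]; omega
    rcases hadm with ⟨h, rfl, rfl⟩ | ⟨h, hm1, hmg, rfl, hk⟩
    · refine ⟨0, by simp, fun i => ?_⟩
      have := card_freeRow_of_large (m₁ := m₁) (m₂ := 0) hseq h i.succ.succ (htwo i)
      rw [hval] at this
      simpa using this
    · refine ⟨fun i => if 2 * m₂ < k i.succ.succ then 1 else 0, ?_, fun i => ?_⟩
      · rw [Finset.sum_boole, Nat.cast_id]
        have hcard : (Finset.univ.filter fun i : Fin n => 2 * m₂ < k i.succ.succ).card ≤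
            (Finset.Ioo m₂ g).card := by
          -- Since d = 2g-2, these orders are even, and their halves are distinct integers strictly
          -- between m₂ and g.
          refine Finset.card_le_card_of_injOn (fun i => k i.succ.succ / 2) ?_ ?_
          · intro i hi
            have hi' : 2 * m₂ < k i.succ.succ := by simpa using hi
            have hle := hseq.le i.succ.succ
            have hp := hseq.even_or_le i.succ.succ
            rw [Nat.even_iff] at hp
            simp only [Finset.coe_Ioo, Set.mem_Ioo]
            omega
          · intro i _ i' _ hii'
            have hle := hseq.le i.succ.succ
            have hp := hseq.even_or_le i.succ.succ
            have hle' := hseq.le i'.succ.succ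
            have hp' := hseq.even_or_le i'.succ.succ
            rw [Nat.even_iff] at hp hp'
            have hii : k i.succ.succ / 2 = k i'.succ.succ / 2 := hii'
            have : k i.succ.succ = k i'.succ.succ := by omega
            exact Fin.succ_injective _ (Fin.succ_injective _ (hseq.strictMono.injective this))
        rw [Nat.card_Ioo] at hcard
        omega
      · have := card_freeRow_of_small hseq h hmg hk i.succ.succ (htwo i)
        rwa [hval] at this
  obtain ⟨z, hz, hrow⟩ := hrow
  have hrows : ∑ i : Fin n, (((freeRow d g m₁ m₂ k i.succ.succ).card : ℤ) +
      (position g (k i.succ.succ) - ((i : ℕ) + 2))) ≤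
      ∑ i : Fin n, (((d : ℤ) + 1 - n - g - 2) + z i) := by
    refine Finset.sum_le_sum fun i _ => ?_
    have := hrow i
    have hi := i.2
    omega
  rw [Finset.sum_add_distrib, Finset.sum_add_distrib, Finset.sum_const, Finset.card_univ,
    Fintype.card_fin, nsmul_eq_mul] at hrows
  have hz' : (∑ i, (z i : ℤ)) ≤ (g - m₁ - 1 : ℕ) := by exact_mod_cast hz
  have h0' : ((freeRow d g m₁ m₂ k 0).card : ℤ) + (n + 2) ≤ d + 1 := by
    have : (freeRow d g m₁ m₂ k 0).card + (n + 2) ≤ d + 1 := by omega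
    exact_mod_cast this
  have h1' : ((freeRow d g m₁ m₂ k 1).card : ℤ) + (n + 3 + (g - m₁ - 1 : ℕ)) ≤ d + 1 := by
    exact_mod_cast h1
  have hsum' : ((FreeIndex n d g m₁ m₂ k).ncard : ℤ) ≤ (freeRow d g m₁ m₂ k 0).card +
      ((freeRow d g m₁ m₂ k 1).card +
        ∑ i : Fin n, ((freeRow d g m₁ m₂ k i.succ.succ).card : ℤ)) := by
    exact_mod_cast hsum
  rw [codimBound]
  push_cast
  nlinarith

theorem position_strictMono {n d g : ℕ} {k : Fin (n + 2) → ℕ} (hseq : IsOrderSequence d g k) :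
    StrictMono fun i => position g (k i) := by
  intro i j hij
  have h := hseq.strictMono hij
  have hi := hseq.even_or_le i
  have hj := hseq.even_or_le j
  rw [Nat.even_iff] at hi hj
  simp only [position]
  split_ifs <;> omega

theorem le_position {n d g : ℕ} {k : Fin (n + 2) → ℕ} (hseq : IsOrderSequence d g k)
    (i : Fin (n + 2)) : (i : ℕ) ≤ position g (k i) := by
  induction i using Fin.induction with
  | zero => simp
  | succ i ih =>
    have := position_strictMono hseq (Fin.castSucc_lt_succ (i := i))
    simp only [Fin.val_castSucc, Fin.val_succ] at *
    omega

theorem le_codimBound {n d g : ℕ} {k : Fin (n + 2) → ℕ} (hseq : IsOrderSequence d g k) :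
    (n * g : ℤ) ≤ codimBound g k := by
  rw [codimBound, le_add_iff_nonneg_right]
  refine Finset.sum_nonneg fun i _ => ?_
  have := le_position hseq i.succ.succ
  simp only [Fin.val_succ] at this
  omega

theorem half_le_position {n d g : ℕ} {k : Fin (n + 2) → ℕ} (hseq : IsOrderSequence d g k)
    (i : Fin (n + 2)) : k i ≤ 2 * position g (k i) := by
  have hi := hseq.even_or_le i
  rw [Nat.even_iff] at hi
  unfold position
  split_ifs <;> omega

theorem sum_le_codimBound {n d g : ℕ} {k : Fin (n + 2) → ℕ} (hseq : IsOrderSequence d g k) :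
    (((n + 1 : ℕ) : ℚ) - 1) * (g : ℚ) +
      ∑ i ∈ Finset.univ.filter (fun i : Fin (n + 2) => 2 ≤ i.val),
        ((k i : ℚ) / 2 - (i.val : ℚ)) ≤ (codimBound g k : ℚ) := by
  have hsum : ∑ i ∈ Finset.univ.filter (fun i : Fin (n + 2) => 2 ≤ i.val),
      ((k i : ℚ) / 2 - (i.val : ℚ)) =
      ∑ i : Fin n, ((k i.succ.succ : ℚ) / 2 - ((i : ℕ) + 2)) := by
    rw [Finset.sum_filter, Fin.sum_univ_succ, Fin.sum_univ_succ]
    rw [if_neg (by simp), if_neg (by simp), zero_add, zero_add]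
    refine Finset.sum_congr rfl fun i _ => ?_
    rw [if_pos (by simp only [Fin.val_succ]; omega)]
    simp only [Fin.val_succ]
    push_cast
    ring
  rw [hsum, codimBound]
  push_cast
  rw [add_sub_cancel_right]
  gcongr with i
  have : (k i.succ.succ : ℚ) ≤ 2 * position g (k i.succ.succ) := by
    exact_mod_cast half_le_position hseq i.succ.succ
  linarith

end

/-! ### From dimension bounds to codimension. -/

section

theorem exists_zariskiDim_eq {σ : Type} [Fintype σ] {Y : Set (σ → ℂ)} (hY : Y.Nonempty) :
    ∃ r : ℕ, zariskiDim Y = r := by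
  have h0 := zariskiDim_nonneg hY
  have h1 := zariskiDim_le_card Y
  generalize zariskiDim Y = x at *
  induction x with
  | bot => simp at h0
  | coe x =>
    induction x with
    | top =>
      have h2 : (⊤ : ℕ∞) ≤ (Fintype.card σ : ℕ) := by exact_mod_cast h1
      exact absurd h2 (by simp)
    | coe x => exact ⟨x, rfl⟩

theorem exists_hasCodim {σ : Type} [Fintype σ] {Y Z : Set (σ → ℂ)} (hYZ : Y ⊆ Z)
    (hY : Y.Nonempty) :
    ∃ r D c : ℕ, zariskiDim Y = r ∧ zariskiDim Z = D ∧ r + c = D ∧ HasCodim Y Z c := by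
  obtain ⟨r, hr⟩ := exists_zariskiDim_eq hY
  obtain ⟨D, hD⟩ := exists_zariskiDim_eq (hY.mono hYZ)
  have hle : r ≤ D := by
    have := zariskiDim_mono hYZ
    rw [hr, hD] at this
    exact_mod_cast this
  obtain ⟨c, rfl⟩ := Nat.exists_eq_add_of_le hle
  refine ⟨r, r + c, c, hr, hD, rfl, ?_⟩
  rw [HasCodim, hr, hD]
  push_cast
  rfl

theorem cuspStratum_subset_cuspidalSet {n d g : ℕ} (hg : 0 < g) (k : Fin (n + 2) → ℕ) :
    cuspStratum (n + 1) d (hyperellipticSemigroup g) k ⊆ cuspidalSet n d g k := by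
  rintro a ⟨hM, v, w, j, hchart, -, hS, -, hk⟩
  obtain ⟨b, θ, E, h1, h2, h3, h4⟩ := exists_normalized_expansion hg hchart hS
  exact ⟨hM.2, b, θ, E, h1, h2.trans hk, h3, h4⟩

theorem cuspLocus_subset_cuspidalSet {n d g : ℕ} (hg : 0 < g) {a : Coeffs (n + 1) d}
    (ha : a ∈ cuspLocus (n + 1) d (hyperellipticSemigroup g)) :
    ∃ k : Fin (n + 2) → ℕ, StrictMono k ∧ a ∈ cuspidalSet n d g k := by
  obtain ⟨hM, v, w, j, hchart, -, hS⟩ := ha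
  obtain ⟨b, θ, E, h1, -, h3, h4⟩ := exists_normalized_expansion hg hchart hS
  obtain ⟨k, hk, hkE⟩ := exists_orderSet_eq_range (linearIndependent_expansion hM.2 h4) h3
  exact ⟨k, hk, hM.2, b, θ, E, h1, hkE, h3, h4⟩

theorem isOrderSequence_of_mem {n d g : ℕ} (hg : 0 < g) {k : Fin (n + 2) → ℕ} (hk : StrictMono k)
    {a : Coeffs (n + 1) d} (ha : a ∈ cuspidalSet n d g k) : IsOrderSequence d g k := by
  obtain ⟨-, b, θ, E, h1, h2, h3, -⟩ := ha
  exact h1.isOrderSequence hg hk h2 h3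

theorem zariskiDim_cuspidalSet_le {n d g : ℕ} (hg : 0 < g) (hnd : n + 1 ≤ d)
    (hd : 2 * g ≤ d + 2) {k : Fin (n + 2) → ℕ} (hk : StrictMono k) {N : ℕ}
    (hN : ((n : ℤ) + 2) * (d + 1) ≤ N + codimBound g k) :
    zariskiDim (cuspidalSet n d g k) ≤ N := by
  classical
  -- Finitely many images suffice: one for each type of chart and each admissible pair (m₁, m₂).
  let Z : Bool × Fin (g + 1) × Fin (g + 1) → Set (Coeffs (n + 1) d) := fun p =>
    if IsOrderSequence d g k ∧ IsAdmissible d g k p.2.1 p.2.2 then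
      Set.range (NormalForm.point p.1 : NormalForm n d g p.2.1 p.2.2 k → _) else ∅
  refine zariskiDim_le_of_subset_iUnion Z N ?_ ?_
  · intro a ha
    have hseq := isOrderSequence_of_mem hg hk ha
    obtain ⟨b, m₁, m₂, hadm, hmem⟩ := mem_range_point hnd hd hseq ha
    have h1 : m₁ < g + 1 := by rcases hadm with h | h <;> omega
    have h2 : m₂ < g + 1 := by rcases hadm with h | h <;> omega
    refine Set.mem_iUnion.mpr ⟨(b, ⟨m₁, h1⟩, ⟨m₂, h2⟩), ?_⟩
    simp only [Z]
    rw [if_pos ⟨hseq, hadm⟩]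
    exact hmem
  · rintro ⟨b, m₁, m₂⟩
    simp only [Z]
    split_ifs with h
    · refine (NormalForm.zariskiDim_range_point_le h.1.zero h.1.one b).trans ?_
      have := card_parameters_le h.1 hd hg h.2
      have hle : (1 + ((n + 2) ^ 2 + (FreeIndex n d g m₁ m₂ k).ncard) : ℕ) ≤ N := by
        have h2 := this.trans hN
        rw [add_le_add_iff_right] at h2
        exact_mod_cast h2
      exact_mod_cast hle
    · rw [zariskiDim_empty]
      exact bot_le

theorem codimBound_le {n d g : ℕ} (hg : 0 < g) (hnd : n + 1 ≤ d)
    (hd : 2 * g ≤ d + 2) {k : Fin (n + 2) → ℕ} (hk : StrictMono k)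
    (hne : (cuspidalSet n d g k).Nonempty) : codimBound g k ≤ ((n : ℤ) + 2) * (d + 1) := by
  obtain ⟨a, ha⟩ := hne
  have hseq := isOrderSequence_of_mem hg hk ha
  obtain ⟨b, m₁, m₂, hadm, -⟩ := mem_range_point hnd hd hseq ha
  refine le_trans ?_ (card_parameters_le hseq hd hg hadm)
  exact le_add_of_nonneg_left (Int.natCast_nonneg _)

/-- Vanishing orders are at most d, so finitely many sequences `k` cover the locus, and each has
`codimBound` at least n g. -/
theorem zariskiDim_cuspLocus_le {n d g : ℕ} (hg : 0 < g) (hnd : n + 1 ≤ d)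
    (hd : 2 * g ≤ d + 2) {N : ℕ} (hN : (n + 2) * (d + 1) ≤ N + n * g) :
    zariskiDim (cuspLocus (n + 1) d (hyperellipticSemigroup g)) ≤ N := by
  classical
  let Z : (Fin (n + 2) → Fin (d + 1)) → Set (Coeffs (n + 1) d) := fun k =>
    if IsOrderSequence d g (fun i => (k i : ℕ)) then cuspidalSet n d g (fun i => (k i : ℕ)) else ∅
  refine zariskiDim_le_of_subset_iUnion Z N ?_ ?_
  · intro a ha
    obtain ⟨k, hk, hmem⟩ := cuspLocus_subset_cuspidalSet hg ha
    have hseq := isOrderSequence_of_mem hg hk hmem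
    refine Set.mem_iUnion.mpr ⟨fun i => ⟨k i, Nat.lt_succ_of_le (hseq.le i)⟩, ?_⟩
    simp only [Z]
    rw [if_pos hseq]
    exact hmem
  · intro k
    simp only [Z]
    split_ifs with h
    · refine zariskiDim_cuspidalSet_le hg hnd hd h.strictMono ?_
      have := le_codimBound h
      have hN' : ((n : ℤ) + 2) * (d + 1) ≤ N + n * g := by exact_mod_cast hN
      linarith
    · rw [zariskiDim_empty]
      exact bot_le

theorem exists_codim_cuspStratum {n d g : ℕ} (hg : 0 < g) (hnd : n + 1 ≤ d)
    (hd : 2 * g ≤ d + 2) (k : Fin (n + 2) → ℕ)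
    (hne : (cuspStratum (n + 1) d (hyperellipticSemigroup g) k).Nonempty) :
    ∃ c : ℕ, HasCodim (cuspStratum (n + 1) d (hyperellipticSemigroup g) k) (Mor (n + 1) d) c ∧
      (((n + 1 : ℕ) : ℚ) - 1) * (g : ℚ) +
        ∑ i ∈ Finset.univ.filter (fun i : Fin (n + 2) => 2 ≤ i.val),
          ((k i : ℚ) / 2 - (i.val : ℚ)) ≤ (c : ℚ) := by
  obtain ⟨r, D, c, hr, hD, hrc, hcod⟩ := exists_hasCodim
    (fun a (ha : a ∈ cuspStratum (n + 1) d (hyperellipticSemigroup g) k) => ha.1) hne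
  refine ⟨c, hcod, ?_⟩
  have hsub := cuspStratum_subset_cuspidalSet (d := d) hg k
  obtain ⟨a, ha⟩ := hne
  have hk : StrictMono k := by
    obtain ⟨-, -, -, -, -, -, -, hk, -⟩ := ha
    exact hk
  have hseq := isOrderSequence_of_mem hg hk (hsub ha)
  refine (sum_le_codimBound hseq).trans ?_
  rw [zariskiDim_Mor (by omega) hnd] at hD
  have hD' : D = (n + 1 + 1) * (d + 1) := by exact_mod_cast hD.symm
  obtain ⟨N, hN⟩ := Int.eq_ofNat_of_zero_le
    (sub_nonneg.mpr (codimBound_le hg hnd hd hk ⟨a, hsub ha⟩))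
  have hrN : r ≤ N := by
    have := (zariskiDim_mono hsub).trans
      (zariskiDim_cuspidalSet_le hg hnd hd hk (N := N) (by linarith))
    rw [hr] at this
    exact_mod_cast this
  have hfinal : codimBound g k ≤ (c : ℤ) := by
    have h1 : (r : ℤ) + c = (n + 1 + 1) * (d + 1) := by rw [hD'] at hrc; exact_mod_cast hrc
    have h2 : (r : ℤ) ≤ N := by exact_mod_cast hrN
    linarith
  exact_mod_cast hfinal

theorem exists_codim_cuspLocus {n d g : ℕ} (hg : 0 < g) (hnd : n + 1 ≤ d)
    (hd : 2 * g ≤ d + 2)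
    (hne : (cuspLocus (n + 1) d (hyperellipticSemigroup g)).Nonempty) :
    ∃ c : ℕ, HasCodim (cuspLocus (n + 1) d (hyperellipticSemigroup g)) (Mor (n + 1) d) c ∧
      (((n + 1 : ℕ) : ℚ) - 1) * (g : ℚ) ≤ (c : ℚ) := by
  obtain ⟨r, D, c, hr, hD, hrc, hcod⟩ := exists_hasCodim
    (fun a (ha : a ∈ cuspLocus (n + 1) d (hyperellipticSemigroup g)) => ha.1) hne
  refine ⟨c, hcod, ?_⟩
  rw [zariskiDim_Mor (by omega) hnd] at hD
  have hD' : D = (n + 1 + 1) * (d + 1) := by exact_mod_cast hD.symm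
  have hle : n * g ≤ (n + 2) * (d + 1) := by
    obtain ⟨a, ha⟩ := hne
    obtain ⟨k, hk, hmem⟩ := cuspLocus_subset_cuspidalSet hg ha
    have h := (le_codimBound (isOrderSequence_of_mem hg hk hmem)).trans
      (codimBound_le hg hnd hd hk ⟨a, hmem⟩)
    exact_mod_cast h
  have hrN : r ≤ (n + 2) * (d + 1) - n * g := by
    have := zariskiDim_cuspLocus_le hg hnd hd (N := (n + 2) * (d + 1) - n * g) (by omega)
    rw [hr] at this
    exact_mod_cast this
  have hfinal : n * g ≤ c := by
    have e : (n + 1 + 1) * (d + 1) = (n + 2) * (d + 1) := rfl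
    omega
  push_cast
  rw [add_sub_cancel_right]
  exact_mod_cast hfinal

end

end HyperellipticCusp

end

theorem theorem2p1 (n d g : ℕ) (hg : 0 < g) (hn : n ≤ 2 * g) (hd : max n (2 * g - 2) ≤ d) :
    (∀ k : Fin (n + 1) → ℕ,
      (HyperellipticCusp.cuspStratum n d (HyperellipticCusp.hyperellipticSemigroup g) k).Nonempty →
      ∃ c : ℕ,
        HyperellipticCusp.HasCodim
          (HyperellipticCusp.cuspStratum n d (HyperellipticCusp.hyperellipticSemigroup g) k)
          (HyperellipticCusp.Mor n d) c ∧
        ((n : ℚ) - 1) * (g : ℚ) +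
            ∑ i ∈ Finset.univ.filter (fun i : Fin (n + 1) => 2 ≤ i.val),
              ((k i : ℚ) / 2 - (i.val : ℚ)) ≤ (c : ℚ)) ∧
    ((HyperellipticCusp.cuspLocus n d (HyperellipticCusp.hyperellipticSemigroup g)).Nonempty →
      ∃ c : ℕ,
        HyperellipticCusp.HasCodim
          (HyperellipticCusp.cuspLocus n d (HyperellipticCusp.hyperellipticSemigroup g))
          (HyperellipticCusp.Mor n d) c ∧
        ((n : ℚ) - 1) * (g : ℚ) ≤ (c : ℚ)) := by
  rw [max_le_iff] at hd
  cases n with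
  | zero =>
    -- For n = 0 the bound is -g plus an empty sum, so any codimension satisfies it.
    have hneg : (((0 : ℕ) : ℚ) - 1) * (g : ℚ) ≤ 0 := by
      have : (0 : ℚ) ≤ g := by positivity
      push_cast
      linarith
    refine ⟨fun k hne => ?_, fun hne => ?_⟩
    · obtain ⟨-, -, c, -, -, -, hcod⟩ := HyperellipticCusp.exists_hasCodim
        (fun a (ha : a ∈ HyperellipticCusp.cuspStratum 0 d
          (HyperellipticCusp.hyperellipticSemigroup g) k) => ha.1) hne
      refine ⟨c, hcod, ?_⟩
      rw [Finset.filter_false_of_mem (by intro i _; omega), Finset.sum_empty, add_zero]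
      exact hneg.trans (by positivity)
    · obtain ⟨-, -, c, -, -, -, hcod⟩ := HyperellipticCusp.exists_hasCodim
        (fun a (ha : a ∈ HyperellipticCusp.cuspLocus 0 d
          (HyperellipticCusp.hyperellipticSemigroup g)) => ha.1) hne
      exact ⟨c, hcod, hneg.trans (by positivity)⟩
  | succ n =>
    exact ⟨HyperellipticCusp.exists_codim_cuspStratum hg hd.1 (by omega),
      HyperellipticCusp.exists_codim_cuspLocus hg hd.1 (by omega)⟩
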